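/- **Problem.** Let $\mathcal X\subset\mathbb R^{n_1}$, $\mathcal Y\subset\mathbb R^{n_2}$ be closed and convex, $A\in\mathbb R^{n\times n_1}$, $B\in\mathbb R^{n\times n_2}$, $b\in\mathbb R^n$. Let $f=\frac1N\sum_{j=1}^N f_j$, where each $f_j$ is real-valued, convex on $\mathcal X$ and differentiable at every point of $\mathcal X$, and let $g:\mathcal Y\to\mathbb R\cup\{+\infty\}$ be proper, convex and Borel measurable. Consider $\min\{f(x)+g(y): x\in\mathcal X,\ y\in\mathcal Y,\ Ax+By=b\}$, and put $F(w)=f(x)+g(y)$ for $w=(x,y,\lambda)$, $\mathcal L(x,y,\lambda)=f(x)+g(y)-\lambda^{\sf T}(Ax+By-b)$ and $\mathcal L_\beta=\mathcal L+\frac\beta2\|Ax+By-b\|^2$. Let $\Omega^*$ be the set of saddle points of $\mathcal L$ on $\mathcal X\times\mathcal Y\times\mathbb R^n$, i.e. of $w^*=(x^*,y^*,\lambda^*)$ in this set with $\mathcal L(x^*,y^*,\lambda)\le\mathcal L(x^*,y^*,\lambda^*)\le\mathcal L(x,y,\lambda^*)$ for all $(x,y,\lambda)$ in it. Write $\|v\|_G^2=v^{\sf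 T}Gv$. **Parameters.** Let $\beta>0$, let $\mathcal H\succ0$ and $L\succeq0$ be symmetric matrices, and let $(\tau,s)\in\Delta=\{(\tau,s):\tau+s>0,\ \tau\le1,\ -\tau^2-s^2-\tau s+\tau+s+1\ge0\}$. Let $\nu>0$ satisfy $\|\nabla f_j(x_1)-\nabla f_j(x_2)\|_{\mathcal H^{-1}}\le\nu\|x_1-x_2\|_{\mathcal H}$ for all $x_1,x_2\in\mathcal X$ and all $j$. For constants $c_1,c_2,c_3>0$, $\varrho\ge1$ and an integer $m>0$ let, for $k=0,1,\dots$, $$m_k=\max\{\lceil c_3k^{\varrho}\rceil,m\},\qquad \eta_k=\min\Big\{\frac{c_1}{m_k(m_k+1)},c_2\Big\}.$$ **Algorithm (SAS-ADMM).** Start from a deterministic $(x^0,y^0,\lambda^0)\in\mathcal X\times\mathcal Y\times\mathbb R^n$ with $\breve x^0=x^0$. For $k=0,1,\dots$ choose a symmetric matrix $\mathcal M_k$ (it may depend on the past of the run) with $\mathcal D_k:=\mathcal M_k-\beta A^{\sf T}A\succeq0$ and set $h^k=-A^{\sf T}[\lambda^k-\beta(Ax^k+By^k-b)]$. Starting from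 $x_1=x^k$, $\breve x_1=\breve x^k$, do for $t=1,\dots,m_k$: with $\beta_t=\frac2{t+1}$, $\gamma_t=\frac2{t\eta_k}$, $\hat x_t=\beta_t\breve x_t+(1-\beta_t)x_t$ and $d_t=\nabla f_{\xi_t}(\hat x_t)+e_t$, $$\breve x_{t+1}=\arg\min_{x\in\mathcal X}\Big\{\langle d_t+h^k,x\rangle+\tfrac{\gamma_t}2\|x-\breve x_t\|_{\mathcal H}^2+\tfrac12\|x-x^k\|_{\mathcal M_k}^2\Big\},\qquad x_{t+1}=\beta_t\breve x_{t+1}+(1-\beta_t)x_t .$$ Here $\xi_t$ is uniform on $\{1,\dots,N\}$ and independent of everything that happened before step $t$, and $e_t$ is an integrable random vector with conditional mean zero given everything that happened before step $t$ (it may depend on $\xi_t$ and on the past). Put $(x^{k+1},\breve x^{k+1})=(x_{m_k+1},\breve x_{m_k+1})$ and $$\lambda^{k+\frac12}=\lambda^k-\tau\beta(Ax^{k+1}+By^k-b),\quad y^{k+1}\in\arg\min_{y\in\mathcal Y}\Big\{\mathcal L_\beta(x^{k+1},y,\lambda^{k+\frac12})+\tfrac12\|y-y^k\|_L^2\Big\},\quad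 \lambda^{k+1}=\lambda^{k+\frac12}-s\beta(Ax^{k+1}+By^{k+1}-b).$$ All iterates are random variables determined without looking into the future. Let $\delta_t=\nabla f(\hat x_t)-d_t$ in each inner iteration. **Theorem.** Let $\kappa\ge1$ be an integer such that for all $k\ge\kappa$: $\eta_k\le\frac1{2\nu}$; $\mathcal D_k\succeq\mathcal D_{k+1}$; and $\mathbb E\|\delta_t\|_{\mathcal H^{-1}}^2\le\sigma^2$ for all inner steps $t=1,\dots,m_k$ of outer iteration $k$, where $\sigma>0$ is a constant. For $k<\kappa$ let the $\delta_t$ have finite second moments, and, in case $\mathcal M_\kappa$ is random, let it be bounded. For $T\ge1$ let $$x_T=\frac1{T+1}\sum_{k=\kappa}^{\kappa+T}x^{k+1},\qquad y_T=\frac1{T+1}\sum_{k=\kappa}^{\kappa+T}y^{k+1},\qquad F(w_T)=f(x_T)+g(y_T).$$ Then for every $w^*\in\Omega^*$ the values $F(w^*)$ and $F(w_T)$ are finite, $F(w_T)$ and $\|Ax_T+By_T-b\|$ are integrable, and, as $T\to\infty$, both $$\big|\mathbb E[F(w_T)-F(w^*)]\big|\qquad\text{and}\qquad\mathbb E\|Ax_T+By_T-b\|$$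 are $\mathcal O(1/T)$ if $\varrho>1$, and $\mathcal O(T^{-1}\log T)$ if $\varrho=1$. -/

import Mathlib

open MeasureTheory ProbabilityTheory Filter Asymptotics
open scoped Matrix

namespace SASADMM

noncomputable section

/-- `ℝⁿ` with the Euclidean norm. -/
abbrev Vec (n : ℕ) : Type := EuclideanSpace ℝ (Fin n)

/-- The product `G v` of a matrix and a column vector. -/
def act {p q : ℕ} (G : Matrix (Fin p) (Fin q) ℝ) (v : Vec q) : Vec p :=
  Matrix.toEuclideanLin G v

/-- The quadratic form `‖v‖_G² = vᵀ G v`. -/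
def sqNormW {q : ℕ} (G : Matrix (Fin q) (Fin q) ℝ) (v : Vec q) : ℝ :=
  inner ℝ v (act G v)

/-- The weighted (semi)norm `‖v‖_G = √(vᵀ G v)`, for positive semidefinite `G`. -/
def normW {q : ℕ} (G : Matrix (Fin q) (Fin q) ℝ) (v : Vec q) : ℝ :=
  Real.sqrt (sqNormW G v)

/-- The data of `min { f(x) + g(y) | x ∈ X, y ∈ Y, A x + B y = b }` with
`f = (1/N) ∑ⱼ fⱼ` and `g : Y → ℝ ∪ {+∞}`. -/
structure Problem (n n₁ n₂ N : ℕ) where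
  X : Set (Vec n₁)
  Y : Set (Vec n₂)
  fj : Fin N → Vec n₁ → ℝ
  g : Vec n₂ → EReal
  A : Matrix (Fin n) (Fin n₁) ℝ
  B : Matrix (Fin n) (Fin n₂) ℝ
  b : Vec n

namespace Problem

variable {n n₁ n₂ N : ℕ} (P : Problem n n₁ n₂ N)

/-- The average `f = (1/N) ∑ⱼ fⱼ`. -/
def f (x : Vec n₁) : ℝ := (1 / (N : ℝ)) * ∑ j, P.fj j x

/-- The constraint residual `A x + B y - b`. -/
def resid (x : Vec n₁) (y : Vec n₂) : Vec n := act P.A x + act P.B y - P.b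

/-- The objective `F(w) = f(x) + g(y)`, with values in `ℝ ∪ {+∞}`. -/
def F (x : Vec n₁) (y : Vec n₂) : EReal := (P.f x : EReal) + P.g y

/-- The Lagrangian `f(x) + g(y) - λᵀ (A x + B y - b)`. -/
def lagr (x : Vec n₁) (y : Vec n₂) (lam : Vec n) : EReal :=
  P.F x y + ((-inner ℝ lam (P.resid x y) : ℝ) : EReal)

/-- The augmented Lagrangian. -/
def augLagr (β : ℝ) (x : Vec n₁) (y : Vec n₂) (lam : Vec n) : EReal :=
  P.lagr x y lam + ((β / 2 * ‖P.resid x y‖ ^ 2 : ℝ) : EReal)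

/-- `(x*, y*, λ*) ∈ X × Y × ℝⁿ` is a saddle point of the Lagrangian. -/
structure IsSaddlePoint (xs : Vec n₁) (ys : Vec n₂) (ls : Vec n) : Prop where
  mem_X : xs ∈ P.X
  mem_Y : ys ∈ P.Y
  le_left : ∀ lam : Vec n, P.lagr xs ys lam ≤ P.lagr xs ys ls
  le_right : ∀ x ∈ P.X, ∀ y ∈ P.Y, P.lagr xs ys ls ≤ P.lagr x y ls

/-- The standing assumptions on the problem: `X`, `Y` closed and convex; every `fⱼ` convex on `X`
and differentiable at the points of `X`; `g` proper and convex on `Y` with values in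
`ℝ ∪ {+∞}` (convexity as convexity of the epigraph), and Borel measurable on `Y`. -/
structure Standing : Prop where
  closed_X : IsClosed P.X
  convex_X : Convex ℝ P.X
  closed_Y : IsClosed P.Y
  convex_Y : Convex ℝ P.Y
  convex_f : ∀ j, ConvexOn ℝ P.X (P.fj j)
  diff_f : ∀ j, ∀ x ∈ P.X, DifferentiableAt ℝ (P.fj j) x
  g_ne_bot : ∀ y ∈ P.Y, P.g y ≠ ⊥
  g_proper : ∃ y ∈ P.Y, P.g y ≠ ⊤
  convex_g : Convex ℝ {p : Vec n₂ × ℝ | p.1 ∈ P.Y ∧ P.g p.1 ≤ (p.2 : EReal)}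
  meas_g : Measurable (fun y : P.Y => P.g y)

/-- `‖∇fⱼ(x₁) - ∇fⱼ(x₂)‖_{H⁻¹} ≤ ν ‖x₁ - x₂‖_H` on `X`, for all `j`. -/
def GradLipschitz (H : Matrix (Fin n₁) (Fin n₁) ℝ) (ν : ℝ) : Prop :=
  ∀ j, ∀ x₁ ∈ P.X, ∀ x₂ ∈ P.X,
    normW H⁻¹ (gradient (P.fj j) x₁ - gradient (P.fj j) x₂) ≤ ν * normW H (x₁ - x₂)

end Problem

/-- The stepsize region `Δ`. -/
def Delta : Set (ℝ × ℝ) :=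
  {p | 0 < p.1 + p.2 ∧ p.1 ≤ 1 ∧
    0 ≤ -p.1 ^ 2 - p.2 ^ 2 - p.1 * p.2 + p.1 + p.2 + 1}

/-- The parameters of the algorithm: penalty `β`, dual stepsizes `τ, s`, proximal matrices `H, L`,
inner iteration counts `m_k` and inner stepsizes `η_k`. -/
structure Params (n₁ n₂ : ℕ) where
  β : ℝ
  τ : ℝ
  s : ℝ
  H : Matrix (Fin n₁) (Fin n₁) ℝ
  L : Matrix (Fin n₂) (Fin n₂) ℝ
  m : ℕ → ℕ
  η : ℕ → ℝ

/-- The random variables appearing in a run. Outer iterates carry the index `k = 0, 1, …`: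
`x k`, `xb k` (for `x̆ᵏ`), `y k`, `lam k`, `lamHalf k` (for `λ^{k+1/2}`) and the matrix `M k`.
Inner quantities of the `k`-th call of the subroutine carry the indices `k` and `t = 1, 2, …`:
`xin k t` (for `x_t`), `xbin k t` (for `x̆_t`), the sampled index `ξ k t` and the random vector
`e k t`. -/
structure Trajectory (n n₁ n₂ N : ℕ) (Ω : Type*) where
  x : ℕ → Ω → Vec n₁
  xb : ℕ → Ω → Vec n₁
  y : ℕ → Ω → Vec n₂
  lam : ℕ → Ω → Vec n
  lamHalf : ℕ → Ω → Vec n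
  M : ℕ → Ω → Matrix (Fin n₁) (Fin n₁) ℝ
  xin : ℕ → ℕ → Ω → Vec n₁
  xbin : ℕ → ℕ → Ω → Vec n₁
  ξ : ℕ → ℕ → Ω → Fin N
  e : ℕ → ℕ → Ω → Vec n₁

namespace Trajectory

variable {n n₁ n₂ N : ℕ} {Ω : Type*} (Z : Trajectory n n₁ n₂ N Ω)

/-- `x̂_t = β_t x̆_t + (1 - β_t) x_t` with `β_t = 2 / (t + 1)`. -/
def xhat (k t : ℕ) (ω : Ω) : Vec n₁ :=
  (2 / ((t : ℝ) + 1)) • Z.xbin k t ω + (1 - 2 / ((t : ℝ) + 1)) • Z.xin k t ω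

/-- `d_t = ∇f_{ξ_t}(x̂_t) + e_t`. -/
def d (P : Problem n n₁ n₂ N) (k t : ℕ) (ω : Ω) : Vec n₁ :=
  gradient (P.fj (Z.ξ k t ω)) (Z.xhat k t ω) + Z.e k t ω

/-- `δ_t = ∇f(x̂_t) - d_t`. -/
def δ (P : Problem n n₁ n₂ N) (k t : ℕ) (ω : Ω) : Vec n₁ :=
  gradient P.f (Z.xhat k t ω) - Z.d P k t ω

/-- `hᵏ = -Aᵀ [λᵏ - β (A xᵏ + B yᵏ - b)]`. -/
def h (P : Problem n n₁ n₂ N) (S : Params n₁ n₂) (k : ℕ) (ω : Ω) : Vec n₁ :=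
  -act P.Aᵀ (Z.lam k ω - S.β • P.resid (Z.x k ω) (Z.y k ω))

/-- `D_k = M_k - β Aᵀ A`. -/
def D (P : Problem n n₁ n₂ N) (S : Params n₁ n₂) (k : ℕ) (ω : Ω) :
    Matrix (Fin n₁) (Fin n₁) ℝ :=
  Z.M k ω - S.β • (P.Aᵀ * P.A)

/-- The objective of the subproblem that defines `x̆_{t+1}`, with `γ_t = 2 / (t η_k)`. -/
def xObj (P : Problem n n₁ n₂ N) (S : Params n₁ n₂) (k t : ℕ) (ω : Ω) (x : Vec n₁) : ℝ :=
  inner ℝ (Z.d P k t ω + Z.h P S k ω) x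
    + (2 / ((t : ℝ) * S.η k)) / 2 * sqNormW S.H (x - Z.xbin k t ω)
    + 1 / 2 * sqNormW (Z.M k ω) (x - Z.x k ω)

/-- The objective of the subproblem that defines `y^{k+1}`. -/
def yObj (P : Problem n n₁ n₂ N) (S : Params n₁ n₂) (k : ℕ) (ω : Ω) (y : Vec n₂) : EReal :=
  P.augLagr S.β (Z.x (k + 1) ω) y (Z.lamHalf k ω)
    + ((1 / 2 * sqNormW S.L (y - Z.y k ω) : ℝ) : EReal)

/-- The update rules of the algorithm, along one outcome `ω`. -/
structure Updates (P : Problem n n₁ n₂ N) (S : Params n₁ n₂) (ω : Ω) : Prop where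
  xb_zero : Z.xb 0 ω = Z.x 0 ω
  D_psd : ∀ k, (Z.D P S k ω).PosSemidef
  xin_one : ∀ k, Z.xin k 1 ω = Z.x k ω
  xbin_one : ∀ k, Z.xbin k 1 ω = Z.xb k ω
  xbin_succ : ∀ k, ∀ t ∈ Finset.Icc 1 (S.m k),
    Z.xbin k (t + 1) ω ∈ P.X ∧ IsMinOn (Z.xObj P S k t ω) P.X (Z.xbin k (t + 1) ω)
  xin_succ : ∀ k, ∀ t ∈ Finset.Icc 1 (S.m k),
    Z.xin k (t + 1) ω = (2 / ((t : ℝ) + 1)) • Z.xbin k (t + 1) ω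
      + (1 - 2 / ((t : ℝ) + 1)) • Z.xin k t ω
  x_succ : ∀ k, Z.x (k + 1) ω = Z.xin k (S.m k + 1) ω
  xb_succ : ∀ k, Z.xb (k + 1) ω = Z.xbin k (S.m k + 1) ω
  lamHalf_eq : ∀ k, Z.lamHalf k ω
    = Z.lam k ω - (S.τ * S.β) • P.resid (Z.x (k + 1) ω) (Z.y k ω)
  y_succ : ∀ k, Z.y (k + 1) ω ∈ P.Y ∧ IsMinOn (Z.yObj P S k ω) P.Y (Z.y (k + 1) ω)
  lam_succ : ∀ k, Z.lam (k + 1) ω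
    = Z.lamHalf k ω - (S.s * S.β) • P.resid (Z.x (k + 1) ω) (Z.y (k + 1) ω)

/-- The probabilistic structure of a run. `𝓖 (k, t)` (lexicographically ordered indices) is the
information available after the first `t` inner steps of outer iteration `k`; in particular
`𝓖 (k, 0)` is what is known when outer iteration `k` starts. Iterates and matrices are
non-anticipating; `ξ_t` is uniform on the `N` indices and independent of the past; `e_t` is
integrable with mean zero given the past (it may depend on `ξ_t` and on the past). -/
structure Sampling [MeasurableSpace Ω] (S : Params n₁ n₂) (μ : Measure Ω)
    (𝓖 : Filtration (ℕ ×ₗ ℕ) (inferInstance : MeasurableSpace Ω)) : Prop where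
  x_meas : ∀ k, StronglyMeasurable[𝓖 (toLex (k, 0))] (Z.x k)
  xb_meas : ∀ k, StronglyMeasurable[𝓖 (toLex (k, 0))] (Z.xb k)
  y_meas : ∀ k, StronglyMeasurable[𝓖 (toLex (k, 0))] (Z.y k)
  lam_meas : ∀ k, StronglyMeasurable[𝓖 (toLex (k, 0))] (Z.lam k)
  M_meas : ∀ k i j, StronglyMeasurable[𝓖 (toLex (k, 0))] (fun ω => Z.M k ω i j)
  xin_meas : ∀ k, ∀ t ∈ Finset.Icc 1 (S.m k),
    StronglyMeasurable[𝓖 (toLex (k, t - 1))] (Z.xin k t)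
  xbin_meas : ∀ k, ∀ t ∈ Finset.Icc 1 (S.m k),
    StronglyMeasurable[𝓖 (toLex (k, t - 1))] (Z.xbin k t)
  ξ_meas : ∀ k, ∀ t ∈ Finset.Icc 1 (S.m k), Measurable[𝓖 (toLex (k, t))] (Z.ξ k t)
  ξ_unif : ∀ k, ∀ t ∈ Finset.Icc 1 (S.m k), ∀ j, μ.real {ω | Z.ξ k t ω = j} = 1 / (N : ℝ)
  ξ_indep : ∀ k, ∀ t ∈ Finset.Icc 1 (S.m k),
    Indep (MeasurableSpace.comap (Z.ξ k t) inferInstance) (𝓖 (toLex (k, t - 1))) μ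
  e_meas : ∀ k, ∀ t ∈ Finset.Icc 1 (S.m k), StronglyMeasurable[𝓖 (toLex (k, t))] (Z.e k t)
  e_int : ∀ k, ∀ t ∈ Finset.Icc 1 (S.m k), Integrable (Z.e k t) μ
  e_mean : ∀ k, ∀ t ∈ Finset.Icc 1 (S.m k), μ[Z.e k t | 𝓖 (toLex (k, t - 1))] =ᵐ[μ] 0

/-- A run of the symmetric accelerated stochastic ADMM from a deterministic starting point
`(x⁰, y⁰, λ⁰) ∈ X × Y × ℝⁿ`. -/
structure IsRun [MeasurableSpace Ω] (P : Problem n n₁ n₂ N) (S : Params n₁ n₂) (μ : Measure Ω)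
    (𝓖 : Filtration (ℕ ×ₗ ℕ) (inferInstance : MeasurableSpace Ω)) : Prop where
  x_zero : ∃ x₀ ∈ P.X, ∀ ω, Z.x 0 ω = x₀
  y_zero : ∃ y₀ ∈ P.Y, ∀ ω, Z.y 0 ω = y₀
  lam_zero : ∃ lam₀, ∀ ω, Z.lam 0 ω = lam₀
  updates : ∀ ω, Z.Updates P S ω
  sampling : Z.Sampling S μ 𝓖

/-- The `x`-part of the ergodic average: the mean of `x̃ᵏ = x^{k+1}` over `κ ≤ k ≤ κ + T`. -/
def xErg (κ T : ℕ) (ω : Ω) : Vec n₁ :=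
  (1 / ((T : ℝ) + 1)) • ∑ k ∈ Finset.Icc κ (κ + T), Z.x (k + 1) ω

/-- The `y`-part of the ergodic average: the mean of `ỹᵏ = y^{k+1}` over `κ ≤ k ≤ κ + T`. -/
def yErg (κ T : ℕ) (ω : Ω) : Vec n₂ :=
  (1 / ((T : ℝ) + 1)) • ∑ k ∈ Finset.Icc κ (κ + T), Z.y (k + 1) ω

end Trajectory

end

end SASADMM

/-!
The inner loop is an accelerated proximal scheme for the linearized `x`-subproblem: multiplied by
`t (t + 1) / 2`, its gap telescopes in `t`, up to a term that is linear in the noise `δ_t` and a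
term `η_k t² ‖δ_t‖²_{H⁻¹} / 2`. The multiplier terms of an outer iteration are differences of a
quadratic form in `(B (y^k - y*), λ^k - λ)`; for `(τ, s) ∈ Δ` what remains is nonnegative once the
optimality conditions of two consecutive `y`-steps are compared. Hence a potential decreases along
the run by at least the Lagrangian gap, up to the noise. Summing, using convexity at the ergodic
averages and letting the test multiplier range over the ball of radius `‖λ*‖ + 1` bounds both the
residual and the objective gap. In expectation the linear noise vanishes, and since
`η_k ≤ c₁ / (m_k (m_k + 1))` the quadratic noise of iteration `k` is at most `c₁ σ² / m_k`, whose
sum is bounded for `ϱ > 1` and logarithmic for `ϱ = 1`.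
-/

namespace SASADMM

open scoped RealInnerProductSpace

section WeightedNorms

variable {p q : ℕ}

theorem act_zero (G : Matrix (Fin p) (Fin q) ℝ) : act G 0 = 0 :=
  map_zero _

theorem act_neg (G : Matrix (Fin p) (Fin q) ℝ) (u : Vec q) : act G (-u) = -act G u :=
  map_neg _ _

theorem act_add (G : Matrix (Fin p) (Fin q) ℝ) (u v : Vec q) : act G (u + v) = act G u + act G v :=
  map_add _ _ _

theorem act_sub (G : Matrix (Fin p) (Fin q) ℝ) (u v : Vec q) : act G (u - v) = act G u - act G v :=
  map_sub _ _ _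

theorem act_smul (G : Matrix (Fin p) (Fin q) ℝ) (c : ℝ) (u : Vec q) :
    act G (c • u) = c • act G u :=
  map_smul _ _ _

theorem act_sum {ι : Type*} (G : Matrix (Fin p) (Fin q) ℝ) (s : Finset ι) (u : ι → Vec q) :
    act G (∑ i ∈ s, u i) = ∑ i ∈ s, act G (u i) :=
  map_sum _ _ _

theorem sub_act (G G' : Matrix (Fin p) (Fin q) ℝ) (u : Vec q) :
    act (G - G') u = act G u - act G' u := by
  simp [act]

theorem smul_act (c : ℝ) (G : Matrix (Fin p) (Fin q) ℝ) (u : Vec q) :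
    act (c • G) u = c • act G u := by
  simp [act]

theorem one_act (u : Vec q) : act (1 : Matrix (Fin q) (Fin q) ℝ) u = u := by
  ext i; simp [act]

theorem mul_act {r : ℕ} (G : Matrix (Fin p) (Fin q) ℝ) (G' : Matrix (Fin q) (Fin r) ℝ)
    (u : Vec r) : act (G * G') u = act G (act G' u) := by
  ext i; simp [act]

theorem continuous_act (G : Matrix (Fin p) (Fin q) ℝ) : Continuous (act G) :=
  LinearMap.continuous_of_finiteDimensional _

theorem inner_transpose_act (G : Matrix (Fin p) (Fin q) ℝ) (u : Vec p) (v : Vec q) :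
    ⟪act Gᵀ u, v⟫ = ⟪u, act G v⟫ := by
  rw [← Matrix.conjTranspose_eq_transpose_of_trivial, act,
    Matrix.toEuclideanLin_conjTranspose_eq_adjoint]
  exact LinearMap.adjoint_inner_left _ _ _

theorem inner_act_comm {G : Matrix (Fin q) (Fin q) ℝ} (hG : G.IsHermitian) (u v : Vec q) :
    ⟪u, act G v⟫ = ⟪v, act G u⟫ := by
  have hGt : Gᵀ = G := by rw [← Matrix.conjTranspose_eq_transpose_of_trivial]; exact hG
  rw [← inner_transpose_act, hGt, real_inner_comm]

theorem sqNormW_nonneg {G : Matrix (Fin q) (Fin q) ℝ} (hG : G.PosSemidef) (v : Vec q) :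
    0 ≤ sqNormW G v := by
  simpa [sqNormW, act] using (Matrix.isPositive_toEuclideanLin_iff.2 hG).inner_nonneg_right v

theorem sqNormW_add {G : Matrix (Fin q) (Fin q) ℝ} (hG : G.IsHermitian) (u v : Vec q) :
    sqNormW G (u + v) = sqNormW G u + 2 * ⟪u, act G v⟫ + sqNormW G v := by
  simp only [sqNormW, act_add, inner_add_left, inner_add_right]
  rw [inner_act_comm hG v u]; ring

theorem sqNormW_smul (G : Matrix (Fin q) (Fin q) ℝ) (c : ℝ) (u : Vec q) :
    sqNormW G (c • u) = c ^ 2 * sqNormW G u := by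
  simp only [sqNormW, act_smul, real_inner_smul_left, real_inner_smul_right]; ring

theorem sqNormW_sub_comm (G : Matrix (Fin q) (Fin q) ℝ) (u v : Vec q) :
    sqNormW G (u - v) = sqNormW G (v - u) := by
  rw [← neg_sub, ← neg_one_smul ℝ, sqNormW_smul]; ring

theorem sqNormW_sub {G : Matrix (Fin q) (Fin q) ℝ} (hG : G.IsHermitian) (u v : Vec q) :
    sqNormW G (u - v) = sqNormW G u - 2 * ⟪u, act G v⟫ + sqNormW G v := by
  simp only [sqNormW, act_sub, inner_sub_left, inner_sub_right]
  rw [inner_act_comm hG v u]; ring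

theorem continuous_sqNormW (G : Matrix (Fin q) (Fin q) ℝ) : Continuous (sqNormW G) :=
  continuous_id.inner (continuous_act G)

theorem two_mul_inner_act_le {G : Matrix (Fin q) (Fin q) ℝ} (hG : G.PosSemidef) (u v : Vec q) :
    2 * ⟪u, act G v⟫ ≤ sqNormW G u + sqNormW G v := by
  have h := sqNormW_nonneg hG (u - v)
  rw [sqNormW_sub hG.isHermitian] at h
  linarith

theorem normW_sq {G : Matrix (Fin q) (Fin q) ℝ} (hG : G.PosSemidef) (u : Vec q) :
    normW G u ^ 2 = sqNormW G u :=
  Real.sq_sqrt (sqNormW_nonneg hG u)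

theorem convexOn_sqNormW {G : Matrix (Fin q) (Fin q) ℝ} (hG : G.PosSemidef) :
    ConvexOn ℝ Set.univ (sqNormW G) := by
  refine ⟨convex_univ, fun u _ v _ a b ha hb hab => ?_⟩
  have hcross := mul_le_mul_of_nonneg_left (two_mul_inner_act_le hG u v) (mul_nonneg ha hb)
  rw [sqNormW_add hG.isHermitian, sqNormW_smul, sqNormW_smul, act_smul, real_inner_smul_left,
    real_inner_smul_right, smul_eq_mul, smul_eq_mul]
  obtain rfl : b = 1 - a := by linarith
  linarith

theorem act_inv_act {H : Matrix (Fin q) (Fin q) ℝ} (hH : H.PosDef) (u : Vec q) :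
    act H⁻¹ (act H u) = u := by
  rw [← mul_act, Matrix.nonsing_inv_mul _ (Matrix.isUnit_iff_isUnit_det _ |>.1 hH.isUnit), one_act]

theorem two_mul_inner_le {H : Matrix (Fin q) (Fin q) ℝ} (hH : H.PosDef) (c : ℝ) (u v : Vec q) :
    2 * c * ⟪u, v⟫ ≤ sqNormW H⁻¹ u + c ^ 2 * sqNormW H v := by
  have h := two_mul_inner_act_le hH.inv.posSemidef u (act H (c • v))
  have hdual : sqNormW H⁻¹ (act H (c • v)) = c ^ 2 * sqNormW H v := by
    rw [← sqNormW_smul, sqNormW, sqNormW, act_inv_act hH, real_inner_comm]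
  rw [hdual, act_inv_act hH, real_inner_smul_right] at h
  linarith

theorem exists_norm_act_le (G : Matrix (Fin p) (Fin q) ℝ) :
    ∃ C : ℝ, 0 < C ∧ ∀ v, ‖act G v‖ ≤ C * ‖v‖ :=
  (LinearMap.toContinuousLinearMap (Matrix.toEuclideanLin G)).bound

theorem exists_sqNormW_le (G : Matrix (Fin q) (Fin q) ℝ) :
    ∃ C : ℝ, 0 < C ∧ ∀ v, sqNormW G v ≤ C * ‖v‖ ^ 2 := by
  obtain ⟨C, hC, h⟩ := exists_norm_act_le G
  refine ⟨C, hC, fun v => (real_inner_le_norm _ _).trans ?_⟩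
  calc ‖v‖ * ‖act G v‖ ≤ ‖v‖ * (C * ‖v‖) := by gcongr; exact h v
    _ = C * ‖v‖ ^ 2 := by ring

theorem exists_le_sqNormW {H : Matrix (Fin q) (Fin q) ℝ} (hH : H.PosDef) :
    ∃ c : ℝ, 0 < c ∧ ∀ v, c * ‖v‖ ^ 2 ≤ sqNormW H v := by
  obtain ⟨C, hC, hC_le⟩ := exists_sqNormW_le H⁻¹
  refine ⟨1 / C, by positivity, fun v => ?_⟩
  have hyoung := two_mul_inner_le hH C v v
  rw [real_inner_self_eq_norm_sq] at hyoung
  have hlower : C * ‖v‖ ^ 2 ≤ C ^ 2 * sqNormW H v := by linarith [hC_le v]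
  rw [div_mul_eq_mul_div, one_mul, div_le_iff₀ hC]
  nlinarith

theorem hasLineDerivAt_sqNormW_sub {G : Matrix (Fin q) (Fin q) ℝ} (hG : G.IsHermitian)
    (u z d : Vec q) :
    HasLineDerivAt ℝ (fun x => sqNormW G (x - u)) (2 * ⟪d, act G (z - u)⟫) z d := by
  have hexpand : (fun r : ℝ => sqNormW G (z + r • d - u)) = fun r =>
      r ^ 2 * sqNormW G d + r * (2 * ⟪d, act G (z - u)⟫) + sqNormW G (z - u) := by
    funext r
    rw [show z + r • d - u = r • d + (z - u) by abel, sqNormW_add hG, sqNormW_smul,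
      real_inner_smul_left]
    ring
  have h := (((hasDerivAt_pow 2 (0 : ℝ)).mul_const (sqNormW G d)).add
    ((hasDerivAt_id (0 : ℝ)).mul_const (2 * ⟪d, act G (z - u)⟫))).add_const (sqNormW G (z - u))
  unfold HasLineDerivAt
  rw [hexpand]
  exact h.congr_deriv (by simp)

end WeightedNorms

section FirstOrder

theorem le_add_of_isMinOn_add {E : Type*} [AddCommGroup E] [Module ℝ E] {C : Set E}
    {ψ ρ : E → ℝ} (hψ : ConvexOn ℝ C ψ) {z x : E} (hz : z ∈ C) (hx : x ∈ C)
    (hmin : IsMinOn (fun y => ψ y + ρ y) C z) {l : ℝ} (hρ : HasLineDerivAt ℝ ρ l z (x - z)) :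
    ψ z ≤ ψ x + l := by
  suffices ψ z - ψ x ≤ l by linarith
  refine ge_of_tendsto hρ.tendsto_slope_zero_right ?_
  filter_upwards [Ioo_mem_nhdsGT one_pos] with r hr
  have hmem : z + r • (x - z) ∈ C := hψ.1.add_smul_sub_mem hz hx ⟨hr.1.le, hr.2.le⟩
  have hle : ψ z + ρ z ≤ ψ (z + r • (x - z)) + ρ (z + r • (x - z)) := isMinOn_iff.1 hmin _ hmem
  have hconv : ψ (z + r • (x - z)) ≤ (1 - r) * ψ z + r * ψ x := by
    rw [show z + r • (x - z) = (1 - r) • z + r • x by module]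
    exact hψ.2 hz hx (by linarith [hr.2]) hr.1.le (by ring)
  rw [smul_eq_mul, inv_mul_eq_div, le_div_iff₀ hr.1]
  linarith

variable {E : Type*} [NormedAddCommGroup E] [InnerProductSpace ℝ E] [CompleteSpace E]

theorem hasDerivAt_gradient_line {φ : E → ℝ} {z d : E} {r : ℝ}
    (h : DifferentiableAt ℝ φ (z + r • d)) :
    HasDerivAt (fun s : ℝ => φ (z + s • d)) ⟪gradient φ (z + r • d), d⟫ r := by
  have hline : HasDerivAt (fun s : ℝ => z + s • d) d r := by
    simpa using ((hasDerivAt_id r).smul_const d).const_add z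
  exact h.hasGradientAt.hasFDerivAt.comp_hasDerivAt r hline

theorem add_inner_gradient_le_of_convexOn {X : Set E} {φ : E → ℝ} (hφ : ConvexOn ℝ X φ)
    {x z : E} (hx : x ∈ X) (hz : z ∈ X) (hd : DifferentiableAt ℝ φ z) :
    φ z + ⟪gradient φ z, x - z⟫ ≤ φ x := by
  have hderiv : HasLineDerivAt ℝ (-φ) (-⟪gradient φ z, x - z⟫) z (x - z) :=
    hd.hasGradientAt.hasFDerivAt.neg.hasLineDerivAt _
  have hmin : IsMinOn (fun y => φ y + (-φ) y) X z := by
    simpa using isMinOn_const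
  linarith [le_add_of_isMinOn_add hφ hz hx hmin hderiv]

end FirstOrder

section SmoothConvex

variable {q : ℕ}

/-- Convexity of `φ` on `X` together with `ν`-Lipschitz continuity of its gradient for the dual pair
of norms `‖·‖_H`, `‖·‖_{H⁻¹}`, in the form in which both enter the analysis: linearizing at `z` and
comparing with `x`, the error at `y` is at most `ν / 2 * ‖y - z‖_H²`. -/
def IsSmoothConvexOn (H : Matrix (Fin q) (Fin q) ℝ) (ν : ℝ) (X : Set (Vec q)) (φ : Vec q → ℝ) :
    Prop :=
  ∀ x ∈ X, ∀ y ∈ X, ∀ z ∈ X,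
    φ y ≤ φ x + ⟪gradient φ z, y - x⟫ + ν / 2 * sqNormW H (y - z)

theorem inner_le_of_normW_inv_le {H : Matrix (Fin q) (Fin q) ℝ} (hH : H.PosDef) {ν r : ℝ}
    (hν : 0 < ν) (hr : 0 < r) {w d : Vec q} (hw : normW H⁻¹ w ≤ ν * normW H (r • d)) :
    ⟪w, d⟫ ≤ ν * r * sqNormW H d := by
  have hsq : sqNormW H⁻¹ w ≤ (ν * r) ^ 2 * sqNormW H d := by
    calc sqNormW H⁻¹ w = normW H⁻¹ w ^ 2 := (normW_sq hH.inv.posSemidef w).symm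
      _ ≤ (ν * normW H (r • d)) ^ 2 := pow_le_pow_left₀ (Real.sqrt_nonneg _) hw 2
      _ = (ν * r) ^ 2 * sqNormW H d := by
        rw [mul_pow, normW_sq hH.posSemidef, sqNormW_smul]; ring
  have hyoung := two_mul_inner_le hH (ν * r) w d
  have hνr : 0 < ν * r := mul_pos hν hr
  nlinarith

theorem le_add_sqNormW_of_gradient_lipschitz {X : Set (Vec q)} (hX : Convex ℝ X) {φ : Vec q → ℝ}
    {H : Matrix (Fin q) (Fin q) ℝ} (hH : H.PosDef) {ν : ℝ} (hν : 0 < ν)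
    (hd : ∀ x ∈ X, DifferentiableAt ℝ φ x)
    (hLip : ∀ x₁ ∈ X, ∀ x₂ ∈ X,
      normW H⁻¹ (gradient φ x₁ - gradient φ x₂) ≤ ν * normW H (x₁ - x₂))
    {x z : Vec q} (hx : x ∈ X) (hz : z ∈ X) :
    φ x ≤ φ z + ⟪gradient φ z, x - z⟫ + ν / 2 * sqNormW H (x - z) := by
  set d := x - z with hd_def
  have hmem : ∀ s ∈ Set.Icc (0 : ℝ) 1, z + s • d ∈ X := fun s hs => hX.add_smul_sub_mem hz hx hs
  let χ : ℝ → ℝ := fun s => φ (z + s • d) - s * ⟪gradient φ z, d⟫ - ν / 2 * s ^ 2 * sqNormW H d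
  have hderiv : ∀ r ∈ Set.Icc (0 : ℝ) 1, HasDerivAt χ
      (⟪gradient φ (z + r • d), d⟫ - ⟪gradient φ z, d⟫ - ν * r * sqNormW H d) r := by
    intro r hr
    refine (((hasDerivAt_gradient_line (hd _ (hmem r hr))).sub
      ((hasDerivAt_id r).mul_const _)).sub
      (((hasDerivAt_pow 2 r).const_mul (ν / 2)).mul_const (sqNormW H d))).congr_deriv ?_
    simp only [Nat.cast_ofNat]
    ring
  have hanti : AntitoneOn χ (Set.Icc 0 1) := by
    refine antitoneOn_of_hasDerivWithinAt_nonpos (convex_Icc 0 1)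
      (fun r hr => (hderiv r hr).continuousAt.continuousWithinAt)
      (fun r hr => (hderiv r (interior_subset hr)).hasDerivWithinAt) (fun r hr => ?_)
    rw [interior_Icc] at hr
    have hlip := hLip _ (hmem r ⟨hr.1.le, hr.2.le⟩) _ hz
    rw [add_sub_cancel_left] at hlip
    have hinner := inner_le_of_normW_inv_le hH hν hr.1 hlip
    rw [inner_sub_left] at hinner
    linarith
  have hends : χ 1 ≤ χ 0 := hanti (by simp) (by simp) zero_le_one
  simp only [χ, one_smul, zero_smul, add_zero, hd_def, add_sub_cancel] at hends
  linarith

theorem isSmoothConvexOn_of_gradient_lipschitz {X : Set (Vec q)} {φ : Vec q → ℝ}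
    {H : Matrix (Fin q) (Fin q) ℝ} (hH : H.PosDef) {ν : ℝ} (hν : 0 < ν) (hφ : ConvexOn ℝ X φ)
    (hd : ∀ x ∈ X, DifferentiableAt ℝ φ x)
    (hLip : ∀ x₁ ∈ X, ∀ x₂ ∈ X,
      normW H⁻¹ (gradient φ x₁ - gradient φ x₂) ≤ ν * normW H (x₁ - x₂)) :
    IsSmoothConvexOn H ν X φ := by
  intro x hx y hy z hz
  have hlower := add_inner_gradient_le_of_convexOn hφ hx hz (hd z hz)
  have hupper := le_add_sqNormW_of_gradient_lipschitz hφ.1 hH hν hd hLip hy hz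
  rw [inner_sub_right] at hlower hupper ⊢
  linarith

end SmoothConvex

section AcceleratedStep

variable {q : ℕ}

theorem prox_three_point {X : Set (Vec q)} (hX : Convex ℝ X) {H M : Matrix (Fin q) (Fin q) ℝ}
    (hH : H.IsHermitian) (hM : M.IsHermitian) {a : ℝ} {c u w z x : Vec q} (hz : z ∈ X)
    (hx : x ∈ X)
    (hmin : IsMinOn (fun y => ⟪c, y⟫ + a / 2 * sqNormW H (y - u) + 1 / 2 * sqNormW M (y - w))
      X z) :
    ⟪c, z - x⟫ + ⟪act M (z - w), z - x⟫
      ≤ a / 2 * (sqNormW H (u - x) - sqNormW H (z - x) - sqNormW H (z - u)) := by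
  have hderiv : HasLineDerivAt ℝ
      (fun y => a / 2 * sqNormW H (y - u) + 1 / 2 * sqNormW M (y - w))
      (a / 2 * (2 * ⟪x - z, act H (z - u)⟫) + 1 / 2 * (2 * ⟪x - z, act M (z - w)⟫)) z (x - z) :=
    HasDerivAt.add (HasDerivAt.const_mul (a / 2) (hasLineDerivAt_sqNormW_sub hH u z (x - z)))
      (HasDerivAt.const_mul (1 / 2) (hasLineDerivAt_sqNormW_sub hM w z (x - z)))
  have hopt := le_add_of_isMinOn_add ((innerₛₗ ℝ c).convexOn hX) hz hx
    (by simpa only [innerₛₗ_apply_apply, ← add_assoc] using hmin) hderiv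
  have hpolar := sqNormW_add hH (x - z) (z - u)
  rw [sub_add_sub_cancel, sqNormW_sub_comm H x u, sqNormW_sub_comm H x z] at hpolar
  have hflip : ⟪act M (z - w), z - x⟫ = -⟪x - z, act M (z - w)⟫ := by
    rw [← inner_neg_left, neg_sub, real_inner_comm]
  rw [hflip, inner_sub_right, hpolar]
  simp only [innerₛₗ_apply_apply] at hopt
  linarith

/-- The gap at `z`, relative to the comparison point `x`, of the problem of minimizing
`φ + ⟨h, ·⟩ + ‖· - c‖_M² / 2` with the last two terms replaced by their linearization at `z`. -/
noncomputable def linearizedGap (φ : Vec q → ℝ) (h : Vec q) (M : Matrix (Fin q) (Fin q) ℝ)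
    (c x z : Vec q) : ℝ :=
  φ z - φ x + ⟪h + act M (z - c), z - x⟫

theorem convexOn_inner_add_act_sub {M : Matrix (Fin q) (Fin q) ℝ} (hM : M.PosSemidef)
    (h c x : Vec q) : ConvexOn ℝ Set.univ (fun z => ⟪h + act M (z - c), z - x⟫) := by
  have hquad : ConvexOn ℝ Set.univ (fun z => sqNormW M (z - x)) := by
    simpa only [Function.comp_def, ← sub_eq_add_neg, Set.preimage_univ] using
      (convexOn_sqNormW hM).translate_left (-x)
  have hlin : ConvexOn ℝ Set.univ (fun z => ⟪h + act M (x - c), z⟫) :=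
    (innerₛₗ ℝ (h + act M (x - c))).convexOn convex_univ
  refine ((hlin.add_const (-⟪h + act M (x - c), x⟫)).add hquad).congr fun z _ => ?_
  simp only [Pi.add_apply]
  rw [show z - c = (x - c) + (z - x) by abel, act_add, ← add_assoc, inner_add_left _ _ (z - x),
    inner_sub_right, sqNormW, real_inner_comm (z - x)]
  ring

variable {H : Matrix (Fin q) (Fin q) ℝ} {ν θ : ℝ} {X : Set (Vec q)} {φ : Vec q → ℝ}

theorem IsSmoothConvexOn.le_of_extrapolation (hφ : IsSmoothConvexOn H ν X φ) (hX : Convex ℝ X)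
    (hθ : θ ∈ Set.Icc 0 1) {x xt xb xb' : Vec q} (hx : x ∈ X) (hxt : xt ∈ X) (hxb : xb ∈ X)
    (hxb' : xb' ∈ X) :
    φ (θ • xb' + (1 - θ) • xt) ≤ (1 - θ) * φ xt + θ * φ x
      + θ * ⟪gradient φ (θ • xb + (1 - θ) • xt), xb' - x⟫
      + ν * θ ^ 2 / 2 * sqNormW H (xb' - xb) := by
  have hcomb : ∀ u ∈ X, θ • u + (1 - θ) • xt ∈ X := fun u hu =>
    hX hu hxt hθ.1 (sub_nonneg.2 hθ.2) (by ring)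
  set G := gradient φ (θ • xb + (1 - θ) • xt)
  have hgrad : (1 - θ) * ⟪G, θ • xb' + (1 - θ) • xt - xt⟫ + θ * ⟪G, θ • xb' + (1 - θ) • xt - x⟫
      = θ * ⟪G, xb' - x⟫ := by
    simp only [inner_sub_right, inner_add_right, real_inner_smul_right]; ring
  have hquad : sqNormW H (θ • xb' + (1 - θ) • xt - (θ • xb + (1 - θ) • xt))
      = θ ^ 2 * sqNormW H (xb' - xb) := by
    rw [← sqNormW_smul]; congr 1; module
  have hxt_model := hφ xt hxt _ (hcomb xb' hxb') _ (hcomb xb hxb)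
  have hx_model := hφ x hx _ (hcomb xb' hxb') _ (hcomb xb hxb)
  rw [hquad] at hxt_model hx_model
  have hconv := add_le_add (mul_le_mul_of_nonneg_left hxt_model (sub_nonneg.2 hθ.2))
    (mul_le_mul_of_nonneg_left hx_model hθ.1)
  linarith

variable {M : Matrix (Fin q) (Fin q) ℝ}

/-- The gradient error `δ` meets `xb - x`, which is independent of the current sample, except for
the increment `xb' - xb`; Young's inequality absorbs the latter into the half of the proximal term
that the smoothness of `φ` leaves over. -/
theorem IsSmoothConvexOn.linearizedGap_le (hφ : IsSmoothConvexOn H ν X φ) (hX : Convex ℝ X)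
    (hH : H.PosDef) (hM : M.PosSemidef) (hθ : θ ∈ Set.Icc 0 1) {a : ℝ} (ha : 0 < a)
    (hνa : 2 * ν * θ ≤ a) {x c xt xb xb' d h : Vec q} (hx : x ∈ X) (hxt : xt ∈ X) (hxb : xb ∈ X)
    (hxb' : xb' ∈ X)
    (hmin : IsMinOn (fun z => ⟪d + h, z⟫ + a / 2 * sqNormW H (z - xb)
      + 1 / 2 * sqNormW M (z - c)) X xb') :
    linearizedGap φ h M c x (θ • xb' + (1 - θ) • xt)
      ≤ (1 - θ) * linearizedGap φ h M c x xt
        + θ * (a / 2 * (sqNormW H (xb - x) - sqNormW H (xb' - x))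
          + ⟪gradient φ (θ • xb + (1 - θ) • xt) - d, xb - x⟫
          + 1 / a * sqNormW H⁻¹ (gradient φ (θ • xb + (1 - θ) • xt) - d)) := by
  set δ := gradient φ (θ • xb + (1 - θ) • xt) - d with hδ
  have hsmooth := hφ.le_of_extrapolation hX hθ hx hxt hxb hxb'
  have hprox := prox_three_point hX hH.isHermitian hM.isHermitian hxb' hx hmin
  have hconv := (convexOn_inner_add_act_sub hM h c x).2 (Set.mem_univ xb') (Set.mem_univ xt)
    hθ.1 (sub_nonneg.2 hθ.2) (by ring)
  have hyoung : ⟪δ, xb' - xb⟫ ≤ 1 / a * sqNormW H⁻¹ δ + a / 4 * sqNormW H (xb' - xb) := by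
    have h := mul_le_mul_of_nonneg_left (two_mul_inner_le hH (a / 2) δ (xb' - xb))
      (one_div_pos.2 ha).le
    field_simp at h ⊢
    linarith
  have hcurv : ν * θ * sqNormW H (xb' - xb) ≤ a / 2 * sqNormW H (xb' - xb) :=
    mul_le_mul_of_nonneg_right (by linarith) (sqNormW_nonneg hH.posSemidef _)
  have hgrad : ⟪gradient φ (θ • xb + (1 - θ) • xt), xb' - x⟫
      = ⟪d, xb' - x⟫ + ⟪δ, xb' - xb⟫ + ⟪δ, xb - x⟫ := by
    rw [add_assoc, ← inner_add_right, sub_add_sub_cancel, ← inner_add_left, hδ, add_sub_cancel]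
  rw [hgrad] at hsmooth
  rw [inner_add_left, add_assoc, add_comm, add_assoc] at hprox
  simp only [smul_eq_mul, inner_add_left _ _ (xb' - x)] at hconv
  have hbracket := mul_le_mul_of_nonneg_left (add_le_add (add_le_add hprox hyoung)
    (by linarith : ν * θ / 2 * sqNormW H (xb' - xb) ≤ a / 4 * sqNormW H (xb' - xb))) hθ.1
  unfold linearizedGap
  linarith

/-- The weights `t (t + 1) / 2` turn the contraction factor `1 - 2 / (t + 1)` into a telescoping
sum. -/
theorem IsSmoothConvexOn.weighted_linearizedGap_le (hφ : IsSmoothConvexOn H ν X φ)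
    (hX : Convex ℝ X) (hH : H.PosDef) (hM : M.PosSemidef) {η t : ℝ} (hν : 0 < ν) (hη₀ : 0 < η)
    (hη : η ≤ 1 / (2 * ν)) (ht : 1 ≤ t) {x c xt xb xb' d h : Vec q} (hx : x ∈ X) (hxt : xt ∈ X)
    (hxb : xb ∈ X) (hxb' : xb' ∈ X)
    (hmin : IsMinOn (fun z => ⟪d + h, z⟫ + (2 / (t * η)) / 2 * sqNormW H (z - xb)
      + 1 / 2 * sqNormW M (z - c)) X xb') :
    t * (t + 1) / 2
        * linearizedGap φ h M c x ((2 / (t + 1)) • xb' + (1 - 2 / (t + 1)) • xt)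
      ≤ (t - 1) * t / 2 * linearizedGap φ h M c x xt
        + 1 / η * (sqNormW H (xb - x) - sqNormW H (xb' - x))
        + (t * ⟪gradient φ ((2 / (t + 1)) • xb + (1 - 2 / (t + 1)) • xt) - d, xb - x⟫
        + η / 2 * (t ^ 2
          * sqNormW H⁻¹ (gradient φ ((2 / (t + 1)) • xb + (1 - 2 / (t + 1)) • xt) - d))) := by
  have ht₀ : 0 < t := by linarith
  have hθ : 2 / (t + 1) ∈ Set.Icc (0 : ℝ) 1 :=
    ⟨by positivity, (div_le_one (by linarith)).2 (by linarith)⟩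
  have hνa : 2 * ν * (2 / (t + 1)) ≤ 2 / (t * η) := by
    rw [le_div_iff₀ (by positivity)] at hη
    rw [mul_div_assoc', div_le_div_iff₀ (by positivity) (by positivity)]
    nlinarith
  have hstep := mul_le_mul_of_nonneg_left
    (hφ.linearizedGap_le hX hH hM hθ (by positivity) hνa hx hxt hxb hxb' hmin)
    (by positivity : 0 ≤ t * (t + 1) / 2)
  refine hstep.trans_eq ?_
  field_simp
  ring

end AcceleratedStep

namespace Problem

variable {n n₁ n₂ N : ℕ} {P : Problem n n₁ n₂ N}

theorem Standing.gradient_f (hP : P.Standing) {x : Vec n₁} (hx : x ∈ P.X) :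
    gradient P.f x = (1 / (N : ℝ)) • ∑ j, gradient (P.fj j) x := by
  have hsum := (HasFDerivAt.fun_sum (u := Finset.univ)
    fun j _ => (hP.diff_f j x hx).hasGradientAt.hasFDerivAt).const_mul (1 / (N : ℝ))
  refine HasGradientAt.gradient ?_
  rw [hasGradientAt_iff_hasFDerivAt, map_smul, map_sum]
  exact hsum

theorem Standing.convexOn_f (hP : P.Standing) : ConvexOn ℝ P.X P.f := by
  have hsum : ConvexOn ℝ P.X (∑ j, P.fj j) :=
    Finset.sum_induction _ (ConvexOn ℝ P.X) (fun _ _ => ConvexOn.add)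
      (convexOn_const 0 hP.convex_X) fun j _ => hP.convex_f j
  refine (hsum.smul (by positivity : (0 : ℝ) ≤ 1 / (N : ℝ))).congr fun x _ => ?_
  simp only [f, Finset.sum_apply, smul_eq_mul]

theorem Standing.continuousOn_f (hP : P.Standing) : ContinuousOn P.f P.X :=
  continuousOn_const.mul (continuousOn_finsetSum _ fun j _ x hx =>
    (hP.diff_f j x hx).continuousAt.continuousWithinAt)

theorem Standing.isSmoothConvexOn_f (hP : P.Standing) {H : Matrix (Fin n₁) (Fin n₁) ℝ}
    (hH : H.PosDef) {ν : ℝ} (hν : 0 < ν) (hLip : P.GradLipschitz H ν) :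
    IsSmoothConvexOn H ν P.X P.f := by
  intro x hx y hy z hz
  have hq : 0 ≤ ν / 2 * sqNormW H (y - z) :=
    mul_nonneg (by positivity) (sqNormW_nonneg hH.posSemidef _)
  have hsum : ∑ j, P.fj j y ≤ ∑ j, (P.fj j x + ⟪gradient (P.fj j) z, y - x⟫
      + ν / 2 * sqNormW H (y - z)) := Finset.sum_le_sum fun j _ =>
    isSmoothConvexOn_of_gradient_lipschitz hH hν (hP.convex_f j) (hP.diff_f j) (hLip j) x hx y hy
      z hz
  have havg := mul_le_mul_of_nonneg_left hsum (by positivity : (0 : ℝ) ≤ 1 / (N : ℝ))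
  have hconst : 1 / (N : ℝ) * (N * (ν / 2 * sqNormW H (y - z))) ≤ ν / 2 * sqNormW H (y - z) := by
    rw [← mul_assoc, one_div]
    exact mul_le_of_le_one_left hq inv_mul_le_one
  rw [hP.gradient_f hz, real_inner_smul_left, sum_inner]
  simp only [Finset.sum_add_distrib, Finset.sum_const, Finset.card_univ, Fintype.card_fin,
    nsmul_eq_mul, mul_add _ _ (_ * _), mul_add _ (∑ j, P.fj j x)] at havg
  unfold f
  linarith

variable (P) in
/-- The effective domain of `g` in `Y`. -/
def dom : Set (Vec n₂) := {y | y ∈ P.Y ∧ P.g y ≠ ⊤}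

variable (P) in
/-- The real value of `g`, meaningful on its effective domain; where `g` is infinite it is `0`. -/
noncomputable def gReal (y : Vec n₂) : ℝ := (P.g y).toReal

theorem Standing.coe_gReal (hP : P.Standing) {y : Vec n₂} (hy : y ∈ P.dom) :
    (P.gReal y : EReal) = P.g y :=
  EReal.coe_toReal hy.2 (hP.g_ne_bot y hy.1)

theorem Standing.convexOn_gReal (hP : P.Standing) : ConvexOn ℝ P.dom P.gReal := by
  have hepi : ∀ y ∈ P.dom, ∀ z ∈ P.dom, ∀ a b : ℝ, 0 ≤ a → 0 ≤ b → a + b = 1 →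
      a • y + b • z ∈ P.Y ∧
        P.g (a • y + b • z) ≤ ((a * P.gReal y + b * P.gReal z : ℝ) : EReal) :=
    fun y hy z hz _ _ ha hb hab => hP.convex_g (x := (y, P.gReal y)) (y := (z, P.gReal z))
      ⟨hy.1, (hP.coe_gReal hy).ge⟩ ⟨hz.1, (hP.coe_gReal hz).ge⟩ ha hb hab
  have hdom : Convex ℝ P.dom := fun y hy z hz a b ha hb hab =>
    have hcomb := hepi y hy z hz a b ha hb hab
    ⟨hcomb.1, (hcomb.2.trans_lt (EReal.coe_lt_top _)).ne⟩
  refine ⟨hdom, fun y hy z hz a b ha hb hab => ?_⟩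
  have hle := (hepi y hy z hz a b ha hb hab).2
  rw [← hP.coe_gReal (hdom hy hz ha hb hab)] at hle
  exact EReal.coe_le_coe_iff.1 hle

theorem Standing.F_eq (hP : P.Standing) (x : Vec n₁) {y : Vec n₂} (hy : y ∈ P.dom) :
    P.F x y = ((P.f x + P.gReal y : ℝ) : EReal) := by
  rw [F, ← hP.coe_gReal hy, EReal.coe_add]

theorem Standing.lagr_eq (hP : P.Standing) (x : Vec n₁) {y : Vec n₂} (hy : y ∈ P.dom)
    (lam : Vec n) :
    P.lagr x y lam = ((P.f x + P.gReal y - ⟪lam, P.resid x y⟫ : ℝ) : EReal) := by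
  rw [lagr, hP.F_eq x hy, ← EReal.coe_add, sub_eq_add_neg]

theorem F_eq_top {x : Vec n₁} {y : Vec n₂} (hy : P.g y = ⊤) : P.F x y = ⊤ := by
  rw [F, hy, EReal.coe_add_top]

section SaddlePoint

variable {xs : Vec n₁} {ys : Vec n₂} {ls : Vec n}

theorem IsSaddlePoint.mem_dom (hw : P.IsSaddlePoint xs ys ls) (hP : P.Standing) : ys ∈ P.dom := by
  refine ⟨hw.mem_Y, fun htop => ?_⟩
  obtain ⟨y, hy, hgy⟩ := hP.g_proper
  have hle := hw.le_right xs hw.mem_X y hy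
  rw [hP.lagr_eq xs ⟨hy, hgy⟩, lagr, F_eq_top htop, EReal.top_add_coe, top_le_iff] at hle
  exact EReal.coe_ne_top _ hle

theorem IsSaddlePoint.resid_eq_zero (hw : P.IsSaddlePoint xs ys ls) (hP : P.Standing) :
    P.resid xs ys = 0 := by
  have hle := hw.le_left (ls - P.resid xs ys)
  rw [hP.lagr_eq _ (hw.mem_dom hP), hP.lagr_eq _ (hw.mem_dom hP), EReal.coe_le_coe_iff,
    inner_sub_left, real_inner_self_eq_norm_sq] at hle
  have hsq : ‖P.resid xs ys‖ ^ 2 ≤ 0 := by linarith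
  simpa using hsq

theorem IsSaddlePoint.objective_le (hw : P.IsSaddlePoint xs ys ls) (hP : P.Standing) {x : Vec n₁}
    (hx : x ∈ P.X) {y : Vec n₂} (hy : y ∈ P.dom) :
    P.f xs + P.gReal ys ≤ P.f x + P.gReal y - ⟪ls, P.resid x y⟫ := by
  have hle := hw.le_right x hx y hy.1
  rw [hP.lagr_eq _ (hw.mem_dom hP), hP.lagr_eq _ hy, EReal.coe_le_coe_iff,
    hw.resid_eq_zero hP, inner_zero_right, sub_zero] at hle
  exact hle

end SaddlePoint

theorem resid_eq_add (x x' : Vec n₁) (y y' : Vec n₂) :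
    P.resid x y = P.resid x' y' + act P.A (x - x') + act P.B (y - y') := by
  simp only [resid, act_sub]; abel

theorem hasLineDerivAt_resid (x : Vec n₁) (z d : Vec n₂) :
    HasLineDerivAt ℝ (P.resid x) (act P.B d) z d := by
  have haffine : (fun r : ℝ => P.resid x (z + r • d)) = fun r => P.resid x z + r • act P.B d := by
    funext r
    simp only [resid, act_add, act_smul]; abel
  unfold HasLineDerivAt
  rw [haffine]
  simpa using ((hasDerivAt_id (0 : ℝ)).smul_const (act P.B d)).const_add (P.resid x z)

theorem hasLineDerivAt_multiplier_add_penalty (β : ℝ) (x : Vec n₁) (lam : Vec n) (z d : Vec n₂) :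
    HasLineDerivAt ℝ (fun y => -⟪lam, P.resid x y⟫ + β / 2 * ‖P.resid x y‖ ^ 2)
      ⟪-lam + β • P.resid x z, act P.B d⟫ z d := by
  have hresid : HasDerivAt (fun r : ℝ => P.resid x (z + r • d)) (act P.B d) 0 :=
    hasLineDerivAt_resid x z d
  refine (((hasDerivAt_const 0 lam).inner ℝ hresid).neg.add
    (hresid.norm_sq.const_mul (β / 2))).congr_deriv ?_
  simp only [zero_smul, add_zero, inner_zero_left, inner_add_left, inner_neg_left,
    real_inner_smul_left]
  ring

section YSubproblem

variable {L : Matrix (Fin n₂) (Fin n₂) ℝ} {β : ℝ} {x : Vec n₁} {lam : Vec n} {u z : Vec n₂}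

theorem Standing.augLagr_add_eq (hP : P.Standing) (L : Matrix (Fin n₂) (Fin n₂) ℝ) (β : ℝ)
    (x : Vec n₁) (lam : Vec n) (u : Vec n₂) {y : Vec n₂} (hy : y ∈ P.dom) :
    P.augLagr β x y lam + ((1 / 2 * sqNormW L (y - u) : ℝ) : EReal)
      = ((P.f x + P.gReal y - ⟪lam, P.resid x y⟫ + β / 2 * ‖P.resid x y‖ ^ 2
        + 1 / 2 * sqNormW L (y - u) : ℝ) : EReal) := by
  rw [augLagr, hP.lagr_eq x hy, ← EReal.coe_add, ← EReal.coe_add]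

theorem Standing.mem_dom_of_isMinOn (hP : P.Standing) (hz : z ∈ P.Y)
    (hmin : IsMinOn (fun y => P.augLagr β x y lam + ((1 / 2 * sqNormW L (y - u) : ℝ) : EReal))
      P.Y z) : z ∈ P.dom := by
  refine ⟨hz, fun htop => ?_⟩
  obtain ⟨y, hy, hgy⟩ := hP.g_proper
  have hle := isMinOn_iff.1 hmin y hy
  rw [hP.augLagr_add_eq L β x lam u ⟨hy, hgy⟩, augLagr, lagr, F_eq_top htop, EReal.top_add_coe,
    EReal.top_add_coe, EReal.top_add_coe, top_le_iff] at hle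
  exact EReal.coe_ne_top _ hle

theorem Standing.variational_ineq_of_isMinOn (hP : P.Standing) (hL : L.IsHermitian) (hz : z ∈ P.Y)
    (hmin : IsMinOn (fun y => P.augLagr β x y lam + ((1 / 2 * sqNormW L (y - u) : ℝ) : EReal))
      P.Y z) {y : Vec n₂} (hy : y ∈ P.dom) :
    P.gReal z ≤ P.gReal y + (⟪-lam + β • P.resid x z, act P.B (y - z)⟫
      + ⟪y - z, act L (z - u)⟫) := by
  have hzd := hP.mem_dom_of_isMinOn hz hmin
  have hderiv : HasLineDerivAt ℝ (fun v => -⟪lam, P.resid x v⟫ + β / 2 * ‖P.resid x v‖ ^ 2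
      + 1 / 2 * sqNormW L (v - u)) (⟪-lam + β • P.resid x z, act P.B (y - z)⟫
      + 1 / 2 * (2 * ⟪y - z, act L (z - u)⟫)) z (y - z) :=
    HasDerivAt.add (hasLineDerivAt_multiplier_add_penalty β x lam z (y - z))
      (HasDerivAt.const_mul (1 / 2) (hasLineDerivAt_sqNormW_sub hL u z (y - z)))
  rw [← mul_assoc, one_div_mul_cancel two_ne_zero, one_mul] at hderiv
  refine le_add_of_isMinOn_add hP.convexOn_gReal hzd hy (isMinOn_iff.2 fun v hv => ?_) hderiv
  have hle := isMinOn_iff.1 hmin v hv.1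
  rw [hP.augLagr_add_eq L β x lam u hzd, hP.augLagr_add_eq L β x lam u hv,
    EReal.coe_le_coe_iff] at hle
  linarith

end YSubproblem

end Problem

section DualForm

variable {E : Type*} [NormedAddCommGroup E] [InnerProductSpace ℝ E] {β τ s : ℝ}

/-- Half the quadratic form of the dual update, in the variables `q = B (y - y*)` and
`l = λ - λ*`; it is the part of the Lyapunov function that sees the multipliers. -/
noncomputable def dualForm (β τ s : ℝ) (q l : E) : ℝ :=
  1 / 2 * ((1 - τ * s / (τ + s)) * β * ‖q‖ ^ 2 - 2 * τ / (τ + s) * ⟪q, l⟫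
    + 1 / (β * (τ + s)) * ‖l‖ ^ 2)

theorem dualForm_eq_sq_add_sq (hβ : β ≠ 0) (hts : τ + s ≠ 0) (q l : E) :
    dualForm β τ s q l = 1 / (2 * (β * (τ + s))) *
      (‖l - (τ * β) • q‖ ^ 2 + (τ + s) * (1 - τ) * β ^ 2 * ‖q‖ ^ 2) := by
  rw [norm_sub_sq_real, norm_smul, mul_pow, Real.norm_eq_abs, sq_abs, real_inner_smul_right,
    real_inner_comm, dualForm]
  field_simp
  ring

theorem dualForm_nonneg (hβ : 0 < β) (hts : 0 < τ + s) (hτ : τ ≤ 1) (q l : E) :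
    0 ≤ dualForm β τ s q l := by
  have := sub_nonneg.2 hτ
  rw [dualForm_eq_sq_add_sq hβ.ne' hts.ne']
  positivity

theorem exists_dualForm_le (β τ s : ℝ) :
    ∃ C : ℝ, 0 ≤ C ∧ ∀ q l : E, dualForm β τ s q l ≤ C * (‖q‖ ^ 2 + ‖l‖ ^ 2) := by
  set a := |(1 - τ * s / (τ + s)) * β|
  set b := |2 * τ / (τ + s)|
  set c := |1 / (β * (τ + s))|
  refine ⟨1 / 2 * (a + b + c), by positivity, fun q l => ?_⟩
  have hquad_q : (1 - τ * s / (τ + s)) * β * ‖q‖ ^ 2 ≤ a * ‖q‖ ^ 2 := by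
    gcongr; exact le_abs_self _
  have hquad_l : 1 / (β * (τ + s)) * ‖l‖ ^ 2 ≤ c * ‖l‖ ^ 2 := by gcongr; exact le_abs_self _
  have hcross : -(2 * τ / (τ + s) * ⟪q, l⟫) ≤ b * (‖q‖ ^ 2 + ‖l‖ ^ 2) := by
    calc -(2 * τ / (τ + s) * ⟪q, l⟫) ≤ |2 * τ / (τ + s) * ⟪q, l⟫| := neg_le_abs _
      _ = b * |⟪q, l⟫| := abs_mul _ _
      _ ≤ b * (‖q‖ * ‖l‖) := by gcongr; exact abs_real_inner_le_norm q l
      _ ≤ b * (‖q‖ ^ 2 + ‖l‖ ^ 2) := by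
        gcongr; nlinarith [sq_nonneg (‖q‖ - ‖l‖), sq_nonneg ‖q‖, sq_nonneg ‖l‖]
  have hslack : 0 ≤ a * ‖l‖ ^ 2 + c * ‖q‖ ^ 2 := by positivity
  rw [dualForm]
  linarith

theorem dualForm_sub_dualForm (hβ : β ≠ 0) (hts : τ + s ≠ 0) (q l p v : E) :
    dualForm β τ s q l - dualForm β τ s (q + v) (l - β • ((τ + s) • p + s • v))
      = ⟪l - β • p, p + v⟫ - β * ⟪q + v, τ • p + v⟫
        + β / 2 * ((2 - τ - s) * ‖p + v‖ ^ 2 - 2 * (1 - τ) * ⟪v, p + v⟫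
          + (1 - τ) * ‖v‖ ^ 2) := by
  simp only [dualForm, ← real_inner_self_eq_norm_sq]
  simp only [inner_add_left, inner_add_right, inner_sub_left, inner_sub_right,
    real_inner_smul_left, real_inner_smul_right]
  rw [real_inner_comm p v, real_inner_comm q v, real_inner_comm l v, real_inner_comm l p,
    real_inner_comm p q, real_inner_comm l q]
  field_simp
  ring

theorem one_add_pos_of_mem_Delta (hΔ : (τ, s) ∈ Delta) : 0 < 1 + τ := by
  obtain ⟨hts, -, hquad⟩ := hΔ
  simp only at hts hquad
  by_contra! hτ
  nlinarith [mul_nonneg (neg_nonneg.2 hτ) (neg_nonneg.2 hτ), mul_nonneg (neg_nonneg.2 hτ) hts.le,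
    sq_nonneg (τ + s)]

/-- With `p = A x' + B y - b`, `v = B (y' - y)` and `r₀` the preceding residual, the defect of
`dualForm_sub_dualForm` is a quadratic form in `p + v`, `v` and `r₀`; the quadratic inequality in
`Delta` is what makes it nonnegative up to telescoping terms. -/
theorem inner_le_dualForm_sub_dualForm (hβ : 0 < β) (hΔ : (τ, s) ∈ Delta) (q l p v r₀ : E)
    {w w₀ : ℝ}
    (hmono : β * ((1 + τ) * ⟪v, p + v⟫ - τ * ‖v‖ ^ 2 - (1 - s) * ⟪v, r₀⟫)
      + (w - w₀) / 2 ≤ 0) :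
    ⟪l - β • p, p + v⟫ - β * ⟪q + v, τ • p + v⟫
      ≤ dualForm β τ s q l - dualForm β τ s (q + v) (l - β • ((τ + s) • p + s • v))
        + β / 2 * ((1 - s) ^ 2 / (1 + τ)) * (‖r₀‖ ^ 2 - ‖p + v‖ ^ 2)
        + (1 - τ) / (1 + τ) / 2 * (w₀ - w) := by
  have hτ := one_add_pos_of_mem_Delta hΔ
  obtain ⟨hts, hτ₁, hquad⟩ := hΔ
  simp only at hts hτ₁ hquad
  rw [dualForm_sub_dualForm hβ.ne' hts.ne']
  set R := ‖p + v‖ ^ 2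
  have hsq : 0 ≤ ‖(1 - τ) • v - (1 - s) • r₀‖ ^ 2 := sq_nonneg _
  rw [norm_sub_sq_real, norm_smul, norm_smul, mul_pow, mul_pow, Real.norm_eq_abs, sq_abs,
    Real.norm_eq_abs, sq_abs, real_inner_smul_left, real_inner_smul_right] at hsq
  have hcoeff : 0 ≤ β / 2 * R * ((1 + τ) * (2 - τ - s) - (1 - s) ^ 2) :=
    mul_nonneg (by positivity) (by linarith)
  have hfactor : β / 2 * ((1 - s) ^ 2 / (1 + τ)) * (‖r₀‖ ^ 2 - R)
      + (1 - τ) / (1 + τ) / 2 * (w₀ - w)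
      = (β / 2 * (1 - s) ^ 2 * (‖r₀‖ ^ 2 - R) + (1 - τ) / 2 * (w₀ - w)) / (1 + τ) := by
    field_simp
  suffices -(β / 2 * ((2 - τ - s) * R - 2 * (1 - τ) * ⟪v, p + v⟫ + (1 - τ) * ‖v‖ ^ 2))
      ≤ (β / 2 * (1 - s) ^ 2 * (‖r₀‖ ^ 2 - R) + (1 - τ) / 2 * (w₀ - w)) / (1 + τ) by
    rw [add_assoc _ (β / 2 * ((1 - s) ^ 2 / (1 + τ)) * _), hfactor]
    linarith
  have hmono' := mul_le_mul_of_nonneg_left hmono (sub_nonneg.2 hτ₁)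
  have hsq' := mul_nonneg (half_pos hβ).le hsq
  rw [le_div_iff₀ hτ]
  linarith

end DualForm

theorem sqNormW_sub_sqNormW_le {q : ℕ} {G : Matrix (Fin q) (Fin q) ℝ} (hG : G.PosSemidef)
    (x u z : Vec q) :
    sqNormW G (z - x) - sqNormW G (u - x) ≤ 2 * ⟪z - x, act G (z - u)⟫ := by
  have hpolar := sqNormW_sub hG.isHermitian (z - x) (z - u)
  rw [sub_sub_sub_cancel_left] at hpolar
  have hnonneg := sqNormW_nonneg hG (z - u)
  linarith

theorem two_div_succ_mem_Icc {t : ℕ} (ht : 1 ≤ t) : 2 / ((t : ℝ) + 1) ∈ Set.Icc (0 : ℝ) 1 := by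
  have ht' : (1 : ℝ) ≤ t := by exact_mod_cast ht
  exact ⟨by positivity, (div_le_one (by linarith)).2 (by linarith)⟩

theorem sum_Icc_le_of_le_sub_add {a V c : ℕ → ℝ} {κ : ℕ} (hV : ∀ k, 0 ≤ V k)
    (hstep : ∀ k ≥ κ, a k ≤ V k - V (k + 1) + c k) (T : ℕ) :
    ∑ k ∈ Finset.Icc κ (κ + T), a k ≤ V κ + ∑ k ∈ Finset.Icc κ (κ + T), c k := by
  suffices ∑ k ∈ Finset.Icc κ (κ + T), a k
      ≤ V κ - V (κ + T + 1) + ∑ k ∈ Finset.Icc κ (κ + T), c k by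
    linarith [hV (κ + T + 1)]
  induction T with
  | zero => simpa using hstep κ le_rfl
  | succ T ih =>
    rw [← add_assoc, Finset.sum_Icc_succ_top (by omega), Finset.sum_Icc_succ_top (by omega)]
    linarith [hstep (κ + T + 1) (by omega)]

theorem sum_Icc_one_div_eq_one (κ T : ℕ) :
    ∑ _k ∈ Finset.Icc κ (κ + T), 1 / ((T : ℝ) + 1) = 1 := by
  rw [Finset.sum_const, Nat.card_Icc, nsmul_eq_mul, show κ + T + 1 - κ = T + 1 by omega]
  push_cast
  field_simp

section MultiplierBall

variable {E : Type*} [NormedAddCommGroup E] [InnerProductSpace ℝ E]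

theorem exists_inner_eq_neg_mul_norm {ρ : ℝ} (hρ : 0 ≤ ρ) (r : E) :
    ∃ l : E, ‖l‖ ≤ ρ ∧ ⟪l, r⟫ = -(ρ * ‖r‖) := by
  rcases eq_or_ne r 0 with rfl | hr
  · exact ⟨0, by simpa using hρ, by simp⟩
  · have hr' : ‖r‖ ≠ 0 := norm_ne_zero_iff.2 hr
    refine ⟨(-(ρ * ‖r‖⁻¹)) • r, ?_, ?_⟩
    · rw [norm_smul, norm_neg, Real.norm_of_nonneg (by positivity), mul_assoc,
        inv_mul_cancel₀ hr', mul_one]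
    · rw [real_inner_smul_left, real_inner_self_eq_norm_sq]; field_simp

/-- Radius `‖ls‖ + 1` leaves a surplus of `‖r‖` over the lower bound `⟪ls, r⟫ ≤ a`. -/
theorem norm_le_and_abs_le_of_forall_sub_inner_le {ls r : E} {a W : ℝ}
    (hupper : ∀ l : E, ‖l‖ ≤ ‖ls‖ + 1 → a - ⟪l, r⟫ ≤ W) (hlower : ⟪ls, r⟫ ≤ a) :
    ‖r‖ ≤ W ∧ |a| ≤ (‖ls‖ + 1) * W := by
  obtain ⟨l, hl, hlr⟩ := exists_inner_eq_neg_mul_norm (by positivity : 0 ≤ ‖ls‖ + 1) r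
  have hW := hupper l hl
  rw [hlr] at hW
  have hCS : -(‖ls‖ * ‖r‖) ≤ ⟪ls, r⟫ := (abs_le.1 (abs_real_inner_le_norm ls r)).1
  have hrW : ‖r‖ ≤ W := by linarith
  have hr := norm_nonneg r
  have hlsW : ‖ls‖ * ‖r‖ ≤ ‖ls‖ * W := by gcongr
  refine ⟨hrW, abs_le.2 ⟨by linarith, ?_⟩⟩
  have : 0 ≤ ‖ls‖ * ‖r‖ := by positivity
  linarith

end MultiplierBall

namespace Params

variable {n₁ n₂ : ℕ} (S : Params n₁ n₂)

/-- The coefficient of the telescoping term `‖x̆ᵏ - x‖_H²` in outer iteration `k`. -/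
noncomputable def weight (k : ℕ) : ℝ := 2 / ((S.m k : ℝ) * (S.m k + 1) * S.η k)

/-- The conditions on the parameters under which the outer iteration is analysed. -/
structure IsAdmissible : Prop where
  β_pos : 0 < S.β
  posDef_H : S.H.PosDef
  posSemidef_L : S.L.PosSemidef
  mem_Delta : (S.τ, S.s) ∈ Delta
  m_pos : ∀ k, 0 < S.m k
  η_pos : ∀ k, 0 < S.η k
  weight_antitone : Antitone S.weight

variable {S}

theorem IsAdmissible.weight_nonneg (hS : S.IsAdmissible) (k : ℕ) : 0 ≤ S.weight k := by
  have := hS.η_pos k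
  unfold weight
  positivity

end Params

namespace Trajectory

variable {n n₁ n₂ N : ℕ} {Ω : Type*} {Z : Trajectory n n₁ n₂ N Ω} {P : Problem n n₁ n₂ N}
  {S : Params n₁ n₂} {ω : Ω}

theorem act_M_eq (Z : Trajectory n n₁ n₂ N Ω) (P : Problem n n₁ n₂ N) (S : Params n₁ n₂) (k : ℕ)
    (ω : Ω) (v : Vec n₁) :
    act (Z.M k ω) v = act (Z.D P S k ω) v + S.β • act P.Aᵀ (act P.A v) := by
  rw [D, sub_act, smul_act, mul_act, sub_add_cancel]

theorem sqNormW_M_eq (Z : Trajectory n n₁ n₂ N Ω) (P : Problem n n₁ n₂ N) (S : Params n₁ n₂)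
    (k : ℕ) (ω : Ω) (v : Vec n₁) :
    sqNormW (Z.M k ω) v = sqNormW (Z.D P S k ω) v + S.β * ‖act P.A v‖ ^ 2 := by
  rw [sqNormW, act_M_eq Z P S, inner_add_right, real_inner_smul_right,
    real_inner_comm (act P.Aᵀ _) v, inner_transpose_act, real_inner_self_eq_norm_sq, sqNormW]

theorem Updates.posSemidef_M (hU : Z.Updates P S ω) (hβ : 0 ≤ S.β) (k : ℕ) :
    (Z.M k ω).PosSemidef := by
  have hAtA := Matrix.posSemidef_conjTranspose_mul_self P.A
  rw [Matrix.conjTranspose_eq_transpose_of_trivial] at hAtA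
  rw [← sub_add_cancel (Z.M k ω) (S.β • (P.Aᵀ * P.A))]
  exact (hU.D_psd k).add (hAtA.smul hβ)

section Feasibility

theorem Updates.inner_succ_mem (hU : Z.Updates P S ω) (hP : P.Standing) {k : ℕ}
    (hx : Z.x k ω ∈ P.X) (hxb : Z.xb k ω ∈ P.X) {j : ℕ} (hj : j ≤ S.m k) :
    Z.xin k (j + 1) ω ∈ P.X ∧ Z.xbin k (j + 1) ω ∈ P.X := by
  induction j with
  | zero => exact ⟨by rwa [hU.xin_one], by rwa [hU.xbin_one]⟩
  | succ j ih =>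
    have ht : j + 1 ∈ Finset.Icc 1 (S.m k) := Finset.mem_Icc.2 ⟨by omega, hj⟩
    have hxbin := (hU.xbin_succ k (j + 1) ht).1
    have hθ := two_div_succ_mem_Icc (Nat.le_add_left 1 j)
    refine ⟨?_, hxbin⟩
    rw [hU.xin_succ k (j + 1) ht]
    exact hP.convex_X hxbin (ih (by omega)).1 hθ.1 (sub_nonneg.2 hθ.2) (by ring)

theorem Updates.mem_X (hU : Z.Updates P S ω) (hP : P.Standing) (h₀ : Z.x 0 ω ∈ P.X) (k : ℕ) :
    Z.x k ω ∈ P.X ∧ Z.xb k ω ∈ P.X := by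
  induction k with
  | zero => exact ⟨h₀, hU.xb_zero ▸ h₀⟩
  | succ k ih =>
    rw [hU.x_succ, hU.xb_succ]
    exact hU.inner_succ_mem hP ih.1 ih.2 le_rfl

theorem Updates.inner_mem (hU : Z.Updates P S ω) (hP : P.Standing) (h₀ : Z.x 0 ω ∈ P.X)
    {k t : ℕ} (ht : t ∈ Finset.Icc 1 (S.m k)) : Z.xin k t ω ∈ P.X ∧ Z.xbin k t ω ∈ P.X := by
  obtain ⟨ht₁, htm⟩ := Finset.mem_Icc.1 ht
  obtain ⟨j, rfl⟩ := Nat.exists_eq_add_of_le' ht₁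
  exact hU.inner_succ_mem hP (hU.mem_X hP h₀ k).1 (hU.mem_X hP h₀ k).2 (by omega)

theorem Updates.xhat_mem (hU : Z.Updates P S ω) (hP : P.Standing) (h₀ : Z.x 0 ω ∈ P.X) {k t : ℕ}
    (ht : t ∈ Finset.Icc 1 (S.m k)) : Z.xhat k t ω ∈ P.X := by
  have hθ := two_div_succ_mem_Icc (Finset.mem_Icc.1 ht).1
  exact hP.convex_X (hU.inner_mem hP h₀ ht).2 (hU.inner_mem hP h₀ ht).1 hθ.1
    (sub_nonneg.2 hθ.2) (by ring)

theorem Updates.y_succ_mem_dom (hU : Z.Updates P S ω) (hP : P.Standing) (k : ℕ) :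
    Z.y (k + 1) ω ∈ P.dom :=
  hP.mem_dom_of_isMinOn (hU.y_succ k).1 (hU.y_succ k).2

theorem Updates.xErg_mem (hU : Z.Updates P S ω) (hP : P.Standing) (h₀ : Z.x 0 ω ∈ P.X)
    (κ T : ℕ) : Z.xErg κ T ω ∈ P.X := by
  rw [xErg, Finset.smul_sum]
  exact hP.convex_X.sum_mem (fun _ _ => by positivity) (sum_Icc_one_div_eq_one κ T)
    fun k _ => (hU.mem_X hP h₀ (k + 1)).1

theorem Updates.yErg_mem (hU : Z.Updates P S ω) (hP : P.Standing) (κ T : ℕ) :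
    Z.yErg κ T ω ∈ P.dom := by
  rw [yErg, Finset.smul_sum]
  exact hP.convexOn_gReal.1.sum_mem (fun _ _ => by positivity) (sum_Icc_one_div_eq_one κ T)
    fun k _ => hU.y_succ_mem_dom hP k

end Feasibility

section XUpdate

variable (Z) in
/-- The gap at `z` of the `x`-subproblem of outer iteration `k`, the minimization of
`f + ⟨hᵏ, ·⟩ + ‖· - xᵏ‖_{M_k}² / 2`, relative to the comparison point `x`. -/
noncomputable def xGap (P : Problem n n₁ n₂ N) (S : Params n₁ n₂) (k : ℕ) (ω : Ω)
    (x z : Vec n₁) : ℝ :=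
  linearizedGap P.f (Z.h P S k ω) (Z.M k ω) (Z.x k ω) x z

variable (Z) in
/-- The contribution of the gradient error of inner step `t` to `t (t + 1) / 2` times the gap of the
`x`-subproblem of outer iteration `k`. -/
noncomputable def stepNoise (P : Problem n n₁ n₂ N) (S : Params n₁ n₂) (x : Vec n₁) (k t : ℕ)
    (ω : Ω) : ℝ :=
  (t : ℝ) * ⟪Z.δ P k t ω, Z.xbin k t ω - x⟫
    + S.η k / 2 * ((t : ℝ) ^ 2 * sqNormW S.H⁻¹ (Z.δ P k t ω))

variable (Z) in
/-- The contribution of all gradient errors of outer iteration `k` to the gap of its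
`x`-subproblem. -/
noncomputable def noise (P : Problem n n₁ n₂ N) (S : Params n₁ n₂) (x : Vec n₁) (k : ℕ) (ω : Ω) :
    ℝ :=
  2 / ((S.m k : ℝ) * (S.m k + 1)) * ∑ t ∈ Finset.Icc 1 (S.m k), Z.stepNoise P S x k t ω

variable {ν : ℝ} {x : Vec n₁} {k : ℕ}

theorem Updates.weighted_xGap_le (hU : Z.Updates P S ω) (hP : P.Standing) (hS : S.IsAdmissible)
    (h₀ : Z.x 0 ω ∈ P.X) (hν : 0 < ν) (hLip : P.GradLipschitz S.H ν) (hη : S.η k ≤ 1 / (2 * ν))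
    (hx : x ∈ P.X) {j : ℕ} (hj : j ≤ S.m k) :
    (j : ℝ) * (j + 1) / 2 * Z.xGap P S k ω x (Z.xin k (j + 1) ω)
      ≤ 1 / S.η k * (sqNormW S.H (Z.xb k ω - x) - sqNormW S.H (Z.xbin k (j + 1) ω - x))
        + ∑ t ∈ Finset.Icc 1 j, Z.stepNoise P S x k t ω := by
  induction j with
  | zero => simp [hU.xbin_one]
  | succ j ih =>
    have ht : j + 1 ∈ Finset.Icc 1 (S.m k) := Finset.mem_Icc.2 ⟨by omega, hj⟩
    have hmem := hU.inner_mem hP h₀ ht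
    have hmin := hU.xbin_succ k (j + 1) ht
    have hstep : ((j + 1 : ℕ) : ℝ) * ((j + 1 : ℕ) + 1) / 2
          * Z.xGap P S k ω x (Z.xin k (j + 1 + 1) ω)
        ≤ ((j + 1 : ℕ) - 1) * ((j + 1 : ℕ) : ℝ) / 2 * Z.xGap P S k ω x (Z.xin k (j + 1) ω)
          + 1 / S.η k * (sqNormW S.H (Z.xbin k (j + 1) ω - x)
            - sqNormW S.H (Z.xbin k (j + 1 + 1) ω - x))
          + Z.stepNoise P S x k (j + 1) ω := by
      rw [hU.xin_succ k (j + 1) ht]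
      exact (hP.isSmoothConvexOn_f hS.posDef_H hν hLip).weighted_linearizedGap_le hP.convex_X
        hS.posDef_H (hU.posSemidef_M hS.β_pos.le k) hν (hS.η_pos k) hη (by simp) hx hmem.1 hmem.2
        hmin.1 hmin.2
    rw [Finset.sum_Icc_succ_top (by omega)]
    have hprev := ih (by omega)
    push_cast at hstep ⊢
    linarith

theorem Updates.xGap_le (hU : Z.Updates P S ω) (hP : P.Standing) (hS : S.IsAdmissible)
    (h₀ : Z.x 0 ω ∈ P.X) (hν : 0 < ν) (hLip : P.GradLipschitz S.H ν) (hη : S.η k ≤ 1 / (2 * ν))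
    (hx : x ∈ P.X) :
    Z.xGap P S k ω x (Z.x (k + 1) ω)
      ≤ S.weight k * (sqNormW S.H (Z.xb k ω - x) - sqNormW S.H (Z.xb (k + 1) ω - x))
        + Z.noise P S x k ω := by
  have hm : (0 : ℝ) < S.m k := by exact_mod_cast hS.m_pos k
  have hη₀ := hS.η_pos k
  have hgap := mul_le_mul_of_nonneg_left
    (hU.weighted_xGap_le hP hS h₀ hν hLip hη hx le_rfl)
    (by positivity : (0 : ℝ) ≤ 2 / ((S.m k : ℝ) * (S.m k + 1)))
  rw [← hU.x_succ, ← hU.xb_succ] at hgap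
  calc Z.xGap P S k ω x (Z.x (k + 1) ω)
      = 2 / ((S.m k : ℝ) * (S.m k + 1))
        * ((S.m k : ℝ) * (S.m k + 1) / 2 * Z.xGap P S k ω x (Z.x (k + 1) ω)) := by field_simp
    _ ≤ _ := hgap
    _ = _ := by
      rw [mul_add (2 / _), noise, Params.weight]
      congr 1
      field_simp

theorem inner_h_add_act_M (Z : Trajectory n n₁ n₂ N Ω) (P : Problem n n₁ n₂ N)
    (S : Params n₁ n₂) (k : ℕ) (ω : Ω) (x z : Vec n₁) :
    ⟪Z.h P S k ω + act (Z.M k ω) (z - Z.x k ω), z - x⟫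
      = -⟪Z.lam k ω - S.β • P.resid z (Z.y k ω), act P.A (z - x)⟫
        + ⟪z - x, act (Z.D P S k ω) (z - Z.x k ω)⟫ := by
  have hresid : P.resid z (Z.y k ω) = P.resid (Z.x k ω) (Z.y k ω) + act P.A (z - Z.x k ω) := by
    simp only [Problem.resid, act_sub]; abel
  have hsplit : Z.h P S k ω + act (Z.M k ω) (z - Z.x k ω)
      = -act P.Aᵀ (Z.lam k ω - S.β • P.resid z (Z.y k ω))
        + act (Z.D P S k ω) (z - Z.x k ω) := by
    rw [act_M_eq Z P S, h, hresid]
    simp only [act_sub, act_smul, act_add]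
    module
  rw [hsplit, inner_add_left, inner_neg_left, inner_transpose_act,
    real_inner_comm (z - x) (act _ _)]

end XUpdate

section YUpdate

theorem Updates.variational_ineq_y (hU : Z.Updates P S ω) (hP : P.Standing)
    (hL : S.L.IsHermitian) (k : ℕ) {y : Vec n₂} (hy : y ∈ P.dom) :
    P.gReal (Z.y (k + 1) ω) ≤ P.gReal y
      + (⟪-Z.lamHalf k ω + S.β • P.resid (Z.x (k + 1) ω) (Z.y (k + 1) ω),
          act P.B (y - Z.y (k + 1) ω)⟫
        + ⟪y - Z.y (k + 1) ω, act S.L (Z.y (k + 1) ω - Z.y k ω)⟫) :=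
  hP.variational_ineq_of_isMinOn hL (hU.y_succ k).1 (hU.y_succ k).2 hy

/-- The optimality conditions of two consecutive `y`-subproblems, tested against each other. -/
theorem Updates.monotone_y (hU : Z.Updates P S ω) (hP : P.Standing) (hL : S.L.PosSemidef)
    (k : ℕ) {p v : Vec n} (hp : P.resid (Z.x (k + 2) ω) (Z.y (k + 1) ω) = p)
    (hv : act P.B (Z.y (k + 2) ω - Z.y (k + 1) ω) = v) :
    S.β * ((1 + S.τ) * ⟪v, p + v⟫ - S.τ * ‖v‖ ^ 2
        - (1 - S.s) * ⟪v, P.resid (Z.x (k + 1) ω) (Z.y (k + 1) ω)⟫)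
      + (sqNormW S.L (Z.y (k + 2) ω - Z.y (k + 1) ω)
        - sqNormW S.L (Z.y (k + 1) ω - Z.y k ω)) / 2 ≤ 0 := by
  have hopt := hU.variational_ineq_y hP hL.isHermitian k (hU.y_succ_mem_dom hP (k + 1))
  have hopt' := hU.variational_ineq_y hP hL.isHermitian (k + 1) (hU.y_succ_mem_dom hP k)
  have hcross := two_mul_inner_act_le hL (Z.y (k + 2) ω - Z.y (k + 1) ω)
    (Z.y (k + 1) ω - Z.y k ω)
  have hhalf : Z.lamHalf k ω = Z.lam (k + 1) ω
      + (S.s * S.β) • P.resid (Z.x (k + 1) ω) (Z.y (k + 1) ω) := by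
    rw [hU.lam_succ, sub_add_cancel]
  have hflip : act P.B (Z.y (k + 1) ω - Z.y (k + 2) ω) = -v := by
    rw [← hv, act_sub, act_sub, neg_sub]
  have hquad : ⟪Z.y (k + 1) ω - Z.y (k + 2) ω, act S.L (Z.y (k + 2) ω - Z.y (k + 1) ω)⟫
      = -sqNormW S.L (Z.y (k + 2) ω - Z.y (k + 1) ω) := by
    rw [← neg_sub, inner_neg_left, sqNormW]
  have hresid : P.resid (Z.x (k + 2) ω) (Z.y (k + 2) ω) = p + v := by
    rw [← hp, ← hv, Problem.resid_eq_add (Z.x (k + 2) ω) (Z.x (k + 2) ω) _ (Z.y (k + 1) ω)]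
    simp [act]
  rw [hhalf, hv] at hopt
  rw [hU.lamHalf_eq, hp, hflip, hquad, hresid] at hopt'
  simp only [inner_add_left, inner_neg_left, real_inner_smul_left] at hopt
  simp only [inner_add_left, inner_sub_left, inner_neg_left, inner_neg_right, real_inner_smul_left,
    real_inner_self_eq_norm_sq] at hopt'
  rw [inner_add_right, real_inner_self_eq_norm_sq, real_inner_comm p v,
    real_inner_comm (P.resid (Z.x (k + 1) ω) (Z.y (k + 1) ω)) v]
  linarith

end YUpdate

section Potential

variable {ν : ℝ} {xs : Vec n₁} {ys : Vec n₂} {ls l : Vec n} {κ : ℕ}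

variable (Z) in
/-- The Lyapunov function of the outer iteration relative to `(xs, ys, l)`; it controls the run from
`k = 1` on, the summand with `y (k - 1)` being degenerate at `k = 0`. -/
noncomputable def potential (P : Problem n n₁ n₂ N) (S : Params n₁ n₂) (xs : Vec n₁)
    (ys : Vec n₂) (l : Vec n) (k : ℕ) (ω : Ω) : ℝ :=
  dualForm S.β S.τ S.s (act P.B (Z.y k ω - ys)) (Z.lam k ω - l)
    + 1 / 2 * sqNormW S.L (Z.y k ω - ys)
    + 1 / 2 * sqNormW (Z.D P S k ω) (Z.x k ω - xs)
    + S.β / 2 * ((1 - S.s) ^ 2 / (1 + S.τ)) * ‖P.resid (Z.x k ω) (Z.y k ω)‖ ^ 2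
    + (1 - S.τ) / (1 + S.τ) / 2 * sqNormW S.L (Z.y k ω - Z.y (k - 1) ω)
    + S.weight k * sqNormW S.H (Z.xb k ω - xs)

theorem Updates.potential_nonneg (hU : Z.Updates P S ω) (hS : S.IsAdmissible) (xs : Vec n₁)
    (ys : Vec n₂) (l : Vec n) (k : ℕ) : 0 ≤ Z.potential P S xs ys l k ω := by
  have hβ := hS.β_pos
  have hτ := one_add_pos_of_mem_Delta hS.mem_Delta
  have hτ₁ : 0 ≤ 1 - S.τ := sub_nonneg.2 hS.mem_Delta.2.1
  have hdual := dualForm_nonneg hβ hS.mem_Delta.1 hS.mem_Delta.2.1 (act P.B (Z.y k ω - ys))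
    (Z.lam k ω - l)
  have hy := sqNormW_nonneg hS.posSemidef_L (Z.y k ω - ys)
  have hx := sqNormW_nonneg (hU.D_psd k) (Z.x k ω - xs)
  have hy' := sqNormW_nonneg hS.posSemidef_L (Z.y k ω - Z.y (k - 1) ω)
  have hxb := sqNormW_nonneg hS.posDef_H.posSemidef (Z.xb k ω - xs)
  have hweight := hS.weight_nonneg k
  unfold potential
  positivity

theorem Updates.multiplier_terms_le (hU : Z.Updates P S ω) (hP : P.Standing)
    (hS : S.IsAdmissible) (hresid : P.resid xs ys = 0) (l : Vec n) (k : ℕ) :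
    ⟪Z.lam (k + 1) ω - S.β • P.resid (Z.x (k + 2) ω) (Z.y (k + 1) ω),
          act P.A (Z.x (k + 2) ω - xs)⟫
        + ⟪-Z.lamHalf (k + 1) ω + S.β • P.resid (Z.x (k + 2) ω) (Z.y (k + 2) ω),
          act P.B (ys - Z.y (k + 2) ω)⟫
        - ⟪l, P.resid (Z.x (k + 2) ω) (Z.y (k + 2) ω)⟫
      ≤ dualForm S.β S.τ S.s (act P.B (Z.y (k + 1) ω - ys)) (Z.lam (k + 1) ω - l)
        - dualForm S.β S.τ S.s (act P.B (Z.y (k + 2) ω - ys)) (Z.lam (k + 2) ω - l)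
        + S.β / 2 * ((1 - S.s) ^ 2 / (1 + S.τ))
          * (‖P.resid (Z.x (k + 1) ω) (Z.y (k + 1) ω)‖ ^ 2
            - ‖P.resid (Z.x (k + 2) ω) (Z.y (k + 2) ω)‖ ^ 2)
        + (1 - S.τ) / (1 + S.τ) / 2 * (sqNormW S.L (Z.y (k + 1) ω - Z.y k ω)
          - sqNormW S.L (Z.y (k + 2) ω - Z.y (k + 1) ω)) := by
  set p := P.resid (Z.x (k + 2) ω) (Z.y (k + 1) ω) with hp
  set v := act P.B (Z.y (k + 2) ω - Z.y (k + 1) ω) with hv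
  set q := act P.B (Z.y (k + 1) ω - ys) with hq
  have hresid' : P.resid (Z.x (k + 2) ω) (Z.y (k + 2) ω) = p + v := by
    simp only [hp, hv, Problem.resid, act_sub]; abel
  have hA : act P.A (Z.x (k + 2) ω - xs) = p - q := by
    rw [hp, Problem.resid_eq_add _ xs _ ys, hresid, zero_add, add_sub_cancel_right]
  have hq' : act P.B (Z.y (k + 2) ω - ys) = q + v := by
    rw [hq, hv, ← act_add, sub_add_sub_cancel']
  have hB : act P.B (ys - Z.y (k + 2) ω) = -(q + v) := by
    rw [← hq', act_sub, act_sub, neg_sub]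
  have hlam : Z.lam (k + 2) ω - l
      = (Z.lam (k + 1) ω - l) - S.β • ((S.τ + S.s) • p + S.s • v) := by
    rw [hU.lam_succ, hU.lamHalf_eq, hresid']; module
  have hdual := inner_le_dualForm_sub_dualForm hS.β_pos hS.mem_Delta q (Z.lam (k + 1) ω - l) p v
    _ (hU.monotone_y hP hS.posSemidef_L k hp.symm hv.symm)
  rw [hresid', hA, hB, hq', hlam, hU.lamHalf_eq]
  refine le_trans (le_of_eq ?_) hdual
  simp only [inner_add_left, inner_add_right, inner_sub_left, inner_sub_right, inner_neg_left,
    inner_neg_right, real_inner_smul_left, real_inner_smul_right]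
  rw [real_inner_comm q p, real_inner_comm q v, real_inner_comm v p]
  ring

theorem Updates.lagrangian_gap_le (hU : Z.Updates P S ω) (hP : P.Standing) (hS : S.IsAdmissible)
    (h₀ : Z.x 0 ω ∈ P.X) (hν : 0 < ν) (hLip : P.GradLipschitz S.H ν) {k : ℕ} (hk : 0 < k)
    (hη : S.η k ≤ 1 / (2 * ν)) (hD : (Z.D P S k ω - Z.D P S (k + 1) ω).PosSemidef)
    (hw : P.IsSaddlePoint xs ys ls) (l : Vec n) :
    P.f (Z.x (k + 1) ω) + P.gReal (Z.y (k + 1) ω) - (P.f xs + P.gReal ys)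
        - ⟪l, P.resid (Z.x (k + 1) ω) (Z.y (k + 1) ω)⟫
      ≤ Z.potential P S xs ys l k ω - Z.potential P S xs ys l (k + 1) ω + Z.noise P S xs k ω := by
  obtain ⟨k, rfl⟩ := Nat.exists_eq_add_of_le' hk
  have hx := hU.xGap_le hP hS h₀ hν hLip hη hw.mem_X
  have hy := hU.variational_ineq_y hP hS.posSemidef_L.isHermitian (k + 1) (hw.mem_dom hP)
  have hmult := hU.multiplier_terms_le hP hS (hw.resid_eq_zero hP) l k
  have hL := sqNormW_sub_sqNormW_le hS.posSemidef_L ys (Z.y (k + 1) ω) (Z.y (k + 1 + 1) ω)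
  have hDk := sqNormW_sub_sqNormW_le (hU.D_psd (k + 1)) xs (Z.x (k + 1) ω) (Z.x (k + 1 + 1) ω)
  have hDmono : sqNormW (Z.D P S (k + 1 + 1) ω) (Z.x (k + 1 + 1) ω - xs)
      ≤ sqNormW (Z.D P S (k + 1) ω) (Z.x (k + 1 + 1) ω - xs) := by
    have := sqNormW_nonneg hD (Z.x (k + 1 + 1) ω - xs)
    rwa [sqNormW, sub_act, inner_sub_right, sub_nonneg] at this
  have hweight := mul_le_mul_of_nonneg_right (hS.weight_antitone (Nat.le_succ (k + 1)))
    (sqNormW_nonneg hS.posDef_H.posSemidef (Z.xb (k + 1 + 1) ω - xs))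
  have hflip : ⟪ys - Z.y (k + 1 + 1) ω, act S.L (Z.y (k + 1 + 1) ω - Z.y (k + 1) ω)⟫
      = -⟪Z.y (k + 1 + 1) ω - ys, act S.L (Z.y (k + 1 + 1) ω - Z.y (k + 1) ω)⟫ := by
    rw [← inner_neg_left, neg_sub]
  rw [xGap, linearizedGap, inner_h_add_act_M] at hx
  rw [hflip] at hy
  simp only [potential, Nat.add_sub_cancel]
  linarith

theorem Updates.sum_lagrangian_gap_le (hU : Z.Updates P S ω) (hP : P.Standing)
    (hS : S.IsAdmissible) (h₀ : Z.x 0 ω ∈ P.X) (hν : 0 < ν) (hLip : P.GradLipschitz S.H ν)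
    (hκ : 0 < κ) (hη : ∀ k ≥ κ, S.η k ≤ 1 / (2 * ν))
    (hD : ∀ k ≥ κ, (Z.D P S k ω - Z.D P S (k + 1) ω).PosSemidef)
    (hw : P.IsSaddlePoint xs ys ls) (l : Vec n) (T : ℕ) :
    ∑ k ∈ Finset.Icc κ (κ + T), (P.f (Z.x (k + 1) ω) + P.gReal (Z.y (k + 1) ω)
        - (P.f xs + P.gReal ys) - ⟪l, P.resid (Z.x (k + 1) ω) (Z.y (k + 1) ω)⟫)
      ≤ Z.potential P S xs ys l κ ω + ∑ k ∈ Finset.Icc κ (κ + T), Z.noise P S xs k ω :=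
  sum_Icc_le_of_le_sub_add (V := fun k => Z.potential P S xs ys l k ω)
    (hU.potential_nonneg hS xs ys l) (fun k hk => hU.lagrangian_gap_le hP hS h₀ hν hLip
      (hκ.trans_le hk) (hη k hk) (hD k hk) hw l) T

theorem sqNormW_D_le (hβ : 0 ≤ S.β) {k : ℕ} {R : ℝ}
    (hR : (R • (1 : Matrix (Fin n₁) (Fin n₁) ℝ) - Z.M k ω).PosSemidef) (v : Vec n₁) :
    sqNormW (Z.D P S k ω) v ≤ R * ‖v‖ ^ 2 := by
  have hM : sqNormW (Z.M k ω) v ≤ R * ‖v‖ ^ 2 := by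
    have := sqNormW_nonneg hR v
    rwa [sqNormW, sub_act, smul_act, one_act, inner_sub_right, real_inner_smul_right,
      real_inner_self_eq_norm_sq, sub_nonneg] at this
  have hA : 0 ≤ S.β * ‖act P.A v‖ ^ 2 := by positivity
  linarith [sqNormW_M_eq Z P S k ω v]

end Potential

section Ergodic

variable {ν : ℝ} {xs : Vec n₁} {ys : Vec n₂} {ls : Vec n} {κ : ℕ}

theorem resid_erg (Z : Trajectory n n₁ n₂ N Ω) (P : Problem n n₁ n₂ N) (κ T : ℕ) (ω : Ω) :
    P.resid (Z.xErg κ T ω) (Z.yErg κ T ω)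
      = (1 / ((T : ℝ) + 1)) • ∑ k ∈ Finset.Icc κ (κ + T),
        P.resid (Z.x (k + 1) ω) (Z.y (k + 1) ω) := by
  have hb : P.b = (1 / ((T : ℝ) + 1)) • ∑ _k ∈ Finset.Icc κ (κ + T), P.b := by
    rw [Finset.smul_sum, ← Finset.sum_smul, sum_Icc_one_div_eq_one, one_smul]
  simp only [Problem.resid, Finset.sum_add_distrib, Finset.sum_sub_distrib, smul_add, smul_sub]
  rw [← hb, xErg, yErg, act_smul, act_smul, act_sum, act_sum]

theorem Updates.objective_erg_le (hU : Z.Updates P S ω) (hP : P.Standing) (h₀ : Z.x 0 ω ∈ P.X)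
    (κ T : ℕ) :
    P.f (Z.xErg κ T ω) + P.gReal (Z.yErg κ T ω)
      ≤ 1 / ((T : ℝ) + 1) * ∑ k ∈ Finset.Icc κ (κ + T),
        (P.f (Z.x (k + 1) ω) + P.gReal (Z.y (k + 1) ω)) := by
  have hf := hP.convexOn_f.map_sum_le (t := Finset.Icc κ (κ + T))
    (w := fun _ => 1 / ((T : ℝ) + 1)) (p := fun k => Z.x (k + 1) ω) (fun _ _ => by positivity)
    (sum_Icc_one_div_eq_one κ T) fun k _ => (hU.mem_X hP h₀ (k + 1)).1
  have hg := hP.convexOn_gReal.map_sum_le (t := Finset.Icc κ (κ + T))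
    (w := fun _ => 1 / ((T : ℝ) + 1)) (p := fun k => Z.y (k + 1) ω) (fun _ _ => by positivity)
    (sum_Icc_one_div_eq_one κ T) fun k _ => hU.y_succ_mem_dom hP k
  simp only [smul_eq_mul] at hf hg
  rw [← Finset.smul_sum, ← Finset.mul_sum] at hf hg
  rw [Finset.sum_add_distrib, mul_add]
  exact add_le_add hf hg

theorem Updates.lagrangian_gap_erg_le (hU : Z.Updates P S ω) (hP : P.Standing)
    (hS : S.IsAdmissible) (h₀ : Z.x 0 ω ∈ P.X) (hν : 0 < ν) (hLip : P.GradLipschitz S.H ν)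
    (hκ : 0 < κ) (hη : ∀ k ≥ κ, S.η k ≤ 1 / (2 * ν))
    (hD : ∀ k ≥ κ, (Z.D P S k ω - Z.D P S (k + 1) ω).PosSemidef)
    (hw : P.IsSaddlePoint xs ys ls) (l : Vec n) (T : ℕ) :
    P.f (Z.xErg κ T ω) + P.gReal (Z.yErg κ T ω) - (P.f xs + P.gReal ys)
        - ⟪l, P.resid (Z.xErg κ T ω) (Z.yErg κ T ω)⟫
      ≤ 1 / ((T : ℝ) + 1) * (Z.potential P S xs ys l κ ω
        + ∑ k ∈ Finset.Icc κ (κ + T), Z.noise P S xs k ω) := by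
  have hobj := hU.objective_erg_le hP h₀ κ T
  have hsum := mul_le_mul_of_nonneg_left
    (hU.sum_lagrangian_gap_le hP hS h₀ hν hLip hκ hη hD hw l T)
    (by positivity : (0 : ℝ) ≤ 1 / ((T : ℝ) + 1))
  have hconst : 1 / ((T : ℝ) + 1) * ∑ _k ∈ Finset.Icc κ (κ + T), (P.f xs + P.gReal ys)
      = P.f xs + P.gReal ys := by
    rw [Finset.mul_sum, ← Finset.sum_mul, sum_Icc_one_div_eq_one, one_mul]
  rw [Finset.sum_sub_distrib, Finset.sum_sub_distrib, mul_sub, mul_sub, hconst] at hsum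
  rw [resid_erg, real_inner_smul_right, inner_sum]
  linarith

theorem Updates.ergodic_le (hU : Z.Updates P S ω) (hP : P.Standing) (hS : S.IsAdmissible)
    (h₀ : Z.x 0 ω ∈ P.X) (hν : 0 < ν) (hLip : P.GradLipschitz S.H ν) (hκ : 0 < κ)
    (hη : ∀ k ≥ κ, S.η k ≤ 1 / (2 * ν))
    (hD : ∀ k ≥ κ, (Z.D P S k ω - Z.D P S (k + 1) ω).PosSemidef)
    (hw : P.IsSaddlePoint xs ys ls) {Φ : ℝ}
    (hΦ : ∀ l : Vec n, ‖l‖ ≤ ‖ls‖ + 1 → Z.potential P S xs ys l κ ω ≤ Φ) (T : ℕ) :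
    ‖P.resid (Z.xErg κ T ω) (Z.yErg κ T ω)‖
        ≤ 1 / ((T : ℝ) + 1) * (Φ + ∑ k ∈ Finset.Icc κ (κ + T), Z.noise P S xs k ω) ∧
      |P.f (Z.xErg κ T ω) + P.gReal (Z.yErg κ T ω) - (P.f xs + P.gReal ys)|
        ≤ (‖ls‖ + 1)
          * (1 / ((T : ℝ) + 1) * (Φ + ∑ k ∈ Finset.Icc κ (κ + T), Z.noise P S xs k ω)) := by
  refine norm_le_and_abs_le_of_forall_sub_inner_le (fun l hl => ?_) ?_
  · refine (hU.lagrangian_gap_erg_le hP hS h₀ hν hLip hκ hη hD hw l T).trans ?_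
    have := hΦ l hl
    gcongr
  · have := hw.objective_le hP (hU.xErg_mem hP h₀ κ T) (hU.yErg_mem hP κ T)
    linarith

end Ergodic

end Trajectory

section Integrability

variable {Ω : Type*} {mΩ : MeasurableSpace Ω} {μ : Measure Ω}

theorem memLp_act {p q : ℕ} (G : Matrix (Fin p) (Fin q) ℝ) {X : Ω → Vec q} (hX : MemLp X 2 μ) :
    MemLp (fun ω => act G (X ω)) 2 μ :=
  (LinearMap.toContinuousLinearMap (Matrix.toEuclideanLin G)).comp_memLp' hX

theorem memLp_two_of_norm_sq_le {E : Type*} [NormedAddCommGroup E] {X : Ω → E} {g : Ω → ℝ}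
    (hX : AEStronglyMeasurable X μ) (hg : Integrable g μ) (hle : ∀ᵐ ω ∂μ, ‖X ω‖ ^ 2 ≤ g ω) :
    MemLp X 2 μ := by
  refine (memLp_two_iff_integrable_sq_norm hX).2 (hg.mono' (hX.norm.pow 2) ?_)
  filter_upwards [hle] with ω hω
  rwa [Real.norm_of_nonneg (sq_nonneg _)]

section InnerProduct

variable {E : Type*} [NormedAddCommGroup E] [InnerProductSpace ℝ E]

theorem integrable_inner_of_memLp {X Y : Ω → E} (hX : MemLp X 2 μ) (hY : MemLp Y 2 μ) :
    Integrable (fun ω => ⟪X ω, Y ω⟫) μ := by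
  refine (hX.norm.integrable_mul hY.norm).mono' (hX.1.inner hY.1) (.of_forall fun ω => ?_)
  exact norm_inner_le_norm (X ω) (Y ω)

theorem integral_inner_eq_zero_of_condExp_eq_zero [CompleteSpace E] [IsFiniteMeasure μ]
    {m : MeasurableSpace Ω} (hm : m ≤ mΩ) {e Y : Ω → E} (he : Integrable e μ)
    (hmean : μ[e | m] =ᵐ[μ] 0) (hY : StronglyMeasurable[m] Y)
    (heY : Integrable (fun ω => ⟪e ω, Y ω⟫) μ) : ∫ ω, ⟪e ω, Y ω⟫ ∂μ = 0 := by
  have hpull : μ[fun ω => ⟪e ω, Y ω⟫ | m] =ᵐ[μ] fun ω => ⟪(μ[e | m]) ω, Y ω⟫ :=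
    condExp_bilin_of_stronglyMeasurable_right (innerSL ℝ) hY heY he
  rw [← integral_condExp hm, integral_congr_ae hpull]
  refine integral_eq_zero_of_ae ?_
  filter_upwards [hmean] with ω hω
  rw [hω, Pi.zero_apply, inner_zero_left, Pi.zero_apply]

end InnerProduct

section WeightedNorms

variable {q : ℕ} {X : Ω → Vec q}

theorem integrable_sqNormW (G : Matrix (Fin q) (Fin q) ℝ) (hX : MemLp X 2 μ) :
    Integrable (fun ω => sqNormW G (X ω)) μ :=
  integrable_inner_of_memLp hX (memLp_act G hX)

theorem memLp_two_of_sqNormW_le {H : Matrix (Fin q) (Fin q) ℝ} (hH : H.PosDef) {g : Ω → ℝ}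
    (hX : AEStronglyMeasurable X μ) (hg : Integrable g μ)
    (hle : ∀ᵐ ω ∂μ, sqNormW H (X ω) ≤ g ω) : MemLp X 2 μ := by
  obtain ⟨c, hc, hH_ge⟩ := exists_le_sqNormW hH
  refine memLp_two_of_norm_sq_le hX (hg.div_const c) ?_
  filter_upwards [hle] with ω hω
  rw [le_div_iff₀' hc]
  exact (hH_ge _).trans hω

end WeightedNorms

theorem measurable_gradient {E : Type*} [NormedAddCommGroup E] [InnerProductSpace ℝ E]
    [CompleteSpace E] [MeasurableSpace E] [BorelSpace E] (φ : E → ℝ) :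
    Measurable (gradient φ) :=
  (InnerProductSpace.toDual ℝ E).symm.continuous.measurable.comp (measurable_fderiv ℝ φ)

theorem integral_apply_of_indep [IsFiniteMeasure μ] {ι : Type*} [Fintype ι] [MeasurableSpace ι]
    [MeasurableSingletonClass ι] {m : MeasurableSpace Ω} {ξ : Ω → ι} (hξ : Measurable[mΩ] ξ)
    (hind : Indep (MeasurableSpace.comap ξ inferInstance) m μ) {V : ι → Ω → ℝ}
    (hV : ∀ j, Measurable[m] (V j)) (hVi : ∀ j, Integrable (V j) μ) :
    ∫ ω, V (ξ ω) ω ∂μ = ∑ j, μ.real (ξ ⁻¹' {j}) * ∫ ω, V j ω ∂μ := by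
  classical
  have hset (j : ι) : MeasurableSet[mΩ] (ξ ⁻¹' {j}) := hξ (measurableSet_singleton j)
  have hpartition (ω : Ω) : V (ξ ω) ω = ∑ j, (ξ ⁻¹' {j}).indicator (V j) ω := by
    simp [Set.indicator_apply]
  simp_rw [hpartition]
  rw [integral_finsetSum _ fun j _ => (hVi j).indicator (hset j)]
  refine Finset.sum_congr rfl fun j _ => ?_
  have hindep : IndepFun ((({j} : Set ι).indicator (1 : ι → ℝ)) ∘ ξ) (V j) μ := by
    have hξV : IndepFun ξ (V j) μ := by
      rw [IndepFun_iff_Indep]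
      exact indep_of_indep_of_le_right hind (hV j).comap_le
    exact hξV.comp (measurable_one.indicator (measurableSet_singleton j)) measurable_id
  have hmul := hindep.integral_fun_mul_eq_mul_integral
    ((measurable_one.indicator (measurableSet_singleton j)).comp hξ).aestronglyMeasurable
    (hVi j).1
  have hcomp : ({j} : Set ι).indicator (1 : ι → ℝ) ∘ ξ = (ξ ⁻¹' {j}).indicator 1 := rfl
  rw [hcomp, integral_indicator_one (hset j)] at hmul
  rw [← hmul]
  refine integral_congr_ae (.of_forall fun ω => ?_)
  by_cases hω : ω ∈ ξ ⁻¹' {j} <;> simp [hω]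

end Integrability

theorem sqNormW_sub_le_of_isMinOn {q : ℕ} {X : Set (Vec q)} (hX : Convex ℝ X)
    {H M : Matrix (Fin q) (Fin q) ℝ} (hH : H.PosDef) (hM : M.PosSemidef) {a : ℝ} (ha : 0 < a)
    {c u w z : Vec q} (hz : z ∈ X) (hw : w ∈ X)
    (hmin : IsMinOn (fun x => ⟪c, x⟫ + a / 2 * sqNormW H (x - u) + 1 / 2 * sqNormW M (x - w))
      X z) :
    sqNormW H (z - w) ≤ 2 * sqNormW H (u - w) + (2 / a) ^ 2 * sqNormW H⁻¹ c := by
  have hprox := prox_three_point hX hH.isHermitian hM.isHermitian hz hw hmin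
  have hM_nonneg : 0 ≤ ⟪act M (z - w), z - w⟫ := by
    rw [real_inner_comm]; exact sqNormW_nonneg hM _
  have hzu := sqNormW_nonneg hH.posSemidef (z - u)
  have hyoung := two_mul_inner_le hH (-(a / 2)) c (z - w)
  have hlinear := mul_le_mul_of_nonneg_left (by nlinarith :
    -⟪c, z - w⟫ ≥ a / 2 * (sqNormW H (z - w) - sqNormW H (u - w))) ha.le
  have hquad : (a / 2) ^ 2 * sqNormW H (z - w)
      ≤ (a / 2) ^ 2 * (2 * sqNormW H (u - w)) + sqNormW H⁻¹ c := by linarith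
  have hscaled := mul_le_mul_of_nonneg_left hquad (sq_nonneg (2 / a))
  have hcancel : (2 / a) ^ 2 * (a / 2) ^ 2 = 1 := by field_simp
  rwa [mul_add, ← mul_assoc, ← mul_assoc, hcancel, one_mul, one_mul] at hscaled

namespace Problem

variable {n n₁ n₂ N : ℕ} {P : Problem n n₁ n₂ N} {Ω : Type*} [MeasurableSpace Ω]
  {μ : Measure Ω} [IsFiniteMeasure μ] {H : Matrix (Fin n₁) (Fin n₁) ℝ} {ν : ℝ} {X : Ω → Vec n₁}
  {z : Vec n₁}

theorem GradLipschitz.memLp_gradient_fj (hLip : P.GradLipschitz H ν) (hH : H.PosDef)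
    (hX : MemLp X 2 μ) (hX_mem : ∀ ω, X ω ∈ P.X) (hz : z ∈ P.X) (j : Fin N) :
    MemLp (fun ω => gradient (P.fj j) (X ω)) 2 μ := by
  have hdiff : MemLp (fun ω => gradient (P.fj j) (X ω) - gradient (P.fj j) z) 2 μ := by
    refine memLp_two_of_sqNormW_le hH.inv
      (((measurable_gradient _).comp_aemeasurable hX.1.aemeasurable).sub_const
        _).aestronglyMeasurable
      ((integrable_sqNormW H (hX.sub (memLp_const z))).const_mul (ν ^ 2)) (.of_forall fun ω => ?_)
    rw [Pi.sub_apply, ← normW_sq hH.inv.posSemidef, ← normW_sq hH.posSemidef, ← mul_pow]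
    exact pow_le_pow_left₀ (Real.sqrt_nonneg _) (hLip j _ (hX_mem ω) _ hz) 2
  exact (hdiff.add (memLp_const _)).ae_eq (.of_forall fun ω => sub_add_cancel _ _)

theorem GradLipschitz.memLp_gradient_f (hLip : P.GradLipschitz H ν) (hP : P.Standing)
    (hH : H.PosDef) (hX : MemLp X 2 μ) (hX_mem : ∀ ω, X ω ∈ P.X) (hz : z ∈ P.X) :
    MemLp (fun ω => gradient P.f (X ω)) 2 μ := by
  simp_rw [fun ω => hP.gradient_f (hX_mem ω)]
  exact (memLp_finsetSum _ fun j _ => hLip.memLp_gradient_fj hH hX hX_mem hz j).const_smul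
    (1 / (N : ℝ))

end Problem

namespace Trajectory

variable {n n₁ n₂ N : ℕ} {Ω : Type*} {Z : Trajectory n n₁ n₂ N Ω} {P : Problem n n₁ n₂ N}
  {S : Params n₁ n₂} {xs : Vec n₁} {ys : Vec n₂} {ls : Vec n} {k t : ℕ}

theorem Updates.norm_sq_act_B_add_sqNormW_L_le {ω : Ω} (hU : Z.Updates P S ω) (hP : P.Standing)
    (hβ : 0 < S.β) (hL : S.L.PosSemidef) (hw : P.IsSaddlePoint xs ys ls) (k : ℕ) :
    S.β * ‖act P.B (Z.y (k + 1) ω - ys)‖ ^ 2 + sqNormW S.L (Z.y (k + 1) ω - ys)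
      ≤ 1 / S.β * ‖Z.lamHalf k ω - ls - S.β • act P.A (Z.x (k + 1) ω - xs)‖ ^ 2
        + sqNormW S.L (Z.y k ω - ys) := by
  have hvar := hU.variational_ineq_y hP hL.isHermitian k (hw.mem_dom hP)
  have hopt := hw.objective_le hP hw.mem_X (hU.y_succ_mem_dom hP k)
  have hpolar := two_mul_inner_act_le hL (Z.y (k + 1) ω - ys) (Z.y k ω - ys)
  rw [P.resid_eq_add xs xs _ ys, hw.resid_eq_zero hP, sub_self, act_zero, zero_add, zero_add]
    at hopt
  rw [P.resid_eq_add _ xs _ ys, hw.resid_eq_zero hP, zero_add, ← neg_sub (Z.y (k + 1) ω) ys,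
    act_neg, inner_neg_left,
    ← sub_sub_sub_cancel_right (Z.y (k + 1) ω) (Z.y k ω) ys, act_sub S.L, inner_sub_right] at hvar
  set u := act P.B (Z.y (k + 1) ω - ys)
  set c := Z.lamHalf k ω - ls - S.β • act P.A (Z.x (k + 1) ω - xs) with hc
  have hexpand : ⟪-Z.lamHalf k ω + S.β • (act P.A (Z.x (k + 1) ω - xs) + u), -u⟫
      = ⟪c, u⟫ + ⟪ls, u⟫ - S.β * ‖u‖ ^ 2 := by
    rw [hc, ← real_inner_self_eq_norm_sq]
    simp only [inner_add_left, inner_sub_left, inner_neg_left, inner_neg_right,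
      real_inner_smul_left]
    ring
  have hyoung : 2 * ⟪c, u⟫ ≤ 1 / S.β * ‖c‖ ^ 2 + S.β * ‖u‖ ^ 2 := by
    have hsq := mul_nonneg (one_div_pos.2 hβ).le (sq_nonneg ‖c - S.β • u‖)
    rw [norm_sub_sq_real, norm_smul, mul_pow, real_inner_smul_right, Real.norm_eq_abs,
      sq_abs] at hsq
    field_simp at hsq ⊢
    linarith
  rw [hexpand] at hvar
  unfold sqNormW at hpolar ⊢
  linarith

variable [MeasurableSpace Ω] {μ : Measure Ω}
  {𝓖 : Filtration (ℕ ×ₗ ℕ) (inferInstance : MeasurableSpace Ω)}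

section Measurability

theorem IsRun.x_zero_mem (hR : Z.IsRun P S μ 𝓖) (ω : Ω) : Z.x 0 ω ∈ P.X := by
  obtain ⟨x₀, hx₀, hx⟩ := hR.x_zero
  exact hx ω ▸ hx₀

theorem IsRun.stronglyMeasurable_x (hR : Z.IsRun P S μ 𝓖) (k : ℕ) : StronglyMeasurable (Z.x k) :=
  (hR.sampling.x_meas k).mono (𝓖.le _)

theorem IsRun.stronglyMeasurable_y (hR : Z.IsRun P S μ 𝓖) (k : ℕ) : StronglyMeasurable (Z.y k) :=
  (hR.sampling.y_meas k).mono (𝓖.le _)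

theorem IsRun.stronglyMeasurable_xbin_succ (hR : Z.IsRun P S μ 𝓖) (ht : t ≤ S.m k) :
    StronglyMeasurable (Z.xbin k (t + 1)) := by
  rcases ht.eq_or_lt with rfl | hlt
  · rw [← funext fun ω => (hR.updates ω).xb_succ k]
    exact (hR.sampling.xb_meas (k + 1)).mono (𝓖.le _)
  · exact (hR.sampling.xbin_meas k (t + 1) (Finset.mem_Icc.2 ⟨by omega, hlt⟩)).mono (𝓖.le _)

theorem Sampling.stronglyMeasurable_xhat (hS : Z.Sampling S μ 𝓖)
    (ht : t ∈ Finset.Icc 1 (S.m k)) : StronglyMeasurable[𝓖 (toLex (k, t - 1))] (Z.xhat k t) :=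
  ((hS.xbin_meas k t ht).const_smul (2 / ((t : ℝ) + 1))).add
    ((hS.xin_meas k t ht).const_smul (1 - 2 / ((t : ℝ) + 1)))

theorem Sampling.measurable_ξ (hS : Z.Sampling S μ 𝓖) (ht : t ∈ Finset.Icc 1 (S.m k)) :
    Measurable (Z.ξ k t) :=
  (hS.ξ_meas k t ht).mono (𝓖.le _) le_rfl

theorem Sampling.measurable_gradient_ξ (hS : Z.Sampling S μ 𝓖) (P : Problem n n₁ n₂ N)
    (ht : t ∈ Finset.Icc 1 (S.m k)) :
    Measurable (fun ω => gradient (P.fj (Z.ξ k t ω)) (Z.xhat k t ω)) := by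
  have hgrad : Measurable (fun p : Fin N × Vec n₁ => gradient (P.fj p.1) p.2) :=
    measurable_from_prod_countable_right fun j => measurable_gradient (P.fj j)
  exact hgrad.comp
    ((hS.measurable_ξ ht).prodMk ((hS.stronglyMeasurable_xhat ht).mono (𝓖.le _)).measurable)

theorem Sampling.measurable_δ (hS : Z.Sampling S μ 𝓖) (P : Problem n n₁ n₂ N)
    (ht : t ∈ Finset.Icc 1 (S.m k)) : Measurable (Z.δ P k t) :=
  ((measurable_gradient P.f).comp
    ((hS.stronglyMeasurable_xhat ht).mono (𝓖.le _)).measurable).sub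
      ((hS.measurable_gradient_ξ P ht).add ((hS.e_meas k t ht).mono (𝓖.le _)).measurable)

theorem Sampling.memLp_δ (hS : Z.Sampling S μ 𝓖) (hH : S.H.PosDef)
    (ht : t ∈ Finset.Icc 1 (S.m k))
    (hδ : Integrable (fun ω => sqNormW S.H⁻¹ (Z.δ P k t ω)) μ) : MemLp (Z.δ P k t) 2 μ :=
  memLp_two_of_sqNormW_le hH.inv (hS.measurable_δ P ht).aestronglyMeasurable hδ
    (.of_forall fun _ => le_rfl)

end Measurability

section Integrability

/-- Square integrability of the iterates entering outer iteration `k`. The iterate `y k` itself need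
not be square-integrable: only its image under `B` and its `L`-seminorm are controlled, both
relative to a point `ys`. -/
structure SqIntegrable (Z : Trajectory n n₁ n₂ N Ω) (P : Problem n n₁ n₂ N) (S : Params n₁ n₂)
    (μ : Measure Ω) (ys : Vec n₂) (k : ℕ) : Prop where
  x : MemLp (Z.x k) 2 μ
  xb : MemLp (Z.xb k) 2 μ
  lam : MemLp (Z.lam k) 2 μ
  act_B : MemLp (fun ω => act P.B (Z.y k ω - ys)) 2 μ
  sqNormW_L : Integrable (fun ω => sqNormW S.L (Z.y k ω - ys)) μ

theorem memLp_xhat (hx : MemLp (Z.xin k t) 2 μ) (hxb : MemLp (Z.xbin k t) 2 μ) :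
    MemLp (Z.xhat k t) 2 μ :=
  (hxb.const_smul (2 / ((t : ℝ) + 1))).add (hx.const_smul (1 - 2 / ((t : ℝ) + 1)))

variable [IsFiniteMeasure μ] {ν : ℝ}

theorem memLp_resid (hresid : P.resid xs ys = 0) {X : Ω → Vec n₁} {Y : Ω → Vec n₂}
    (hX : MemLp X 2 μ) (hY : MemLp (fun ω => act P.B (Y ω - ys)) 2 μ) :
    MemLp (fun ω => P.resid (X ω) (Y ω)) 2 μ := by
  simp_rw [fun ω => P.resid_eq_add (X ω) xs (Y ω) ys, hresid, zero_add]
  exact (memLp_act P.A (hX.sub (memLp_const xs))).add hY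

theorem SqIntegrable.memLp_h (hk : Z.SqIntegrable P S μ ys k) (hresid : P.resid xs ys = 0) :
    MemLp (Z.h P S k) 2 μ :=
  (memLp_act P.Aᵀ (hk.lam.sub ((memLp_resid hresid hk.x hk.act_B).const_smul S.β))).neg

theorem IsRun.memLp_gradient_xhat (hR : Z.IsRun P S μ 𝓖) (hP : P.Standing) (hH : S.H.PosDef)
    (hLip : P.GradLipschitz S.H ν) (ht : t ∈ Finset.Icc 1 (S.m k))
    (hxhat : MemLp (Z.xhat k t) 2 μ) : MemLp (fun ω => gradient P.f (Z.xhat k t ω)) 2 μ := by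
  obtain ⟨x₀, hx₀, -⟩ := hR.x_zero
  exact hLip.memLp_gradient_f hP hH hxhat
    (fun ω => (hR.updates ω).xhat_mem hP (hR.x_zero_mem ω) ht) hx₀

theorem IsRun.memLp_d (hR : Z.IsRun P S μ 𝓖) (hP : P.Standing) (hH : S.H.PosDef)
    (hLip : P.GradLipschitz S.H ν) (ht : t ∈ Finset.Icc 1 (S.m k))
    (hxhat : MemLp (Z.xhat k t) 2 μ) (hδ : MemLp (Z.δ P k t) 2 μ) : MemLp (Z.d P k t) 2 μ :=
  ((hR.memLp_gradient_xhat hP hH hLip ht hxhat).sub hδ).ae_eq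
    (.of_forall fun _ => sub_sub_cancel _ _)

theorem IsRun.memLp_xbin_succ (hR : Z.IsRun P S μ 𝓖) (hP : P.Standing) (hS : S.IsAdmissible)
    (hLip : P.GradLipschitz S.H ν) (hresid : P.resid xs ys = 0)
    (hk : Z.SqIntegrable P S μ ys k) (ht : t ∈ Finset.Icc 1 (S.m k))
    (hxin : MemLp (Z.xin k t) 2 μ) (hxbin : MemLp (Z.xbin k t) 2 μ)
    (hδ : MemLp (Z.δ P k t) 2 μ) : MemLp (Z.xbin k (t + 1)) 2 μ := by
  have ht_pos : (0 : ℝ) < t := by exact_mod_cast (Finset.mem_Icc.1 ht).1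
  have hγ : 0 < 2 / ((t : ℝ) * S.η k) := div_pos two_pos (mul_pos ht_pos (hS.η_pos k))
  have hd := hR.memLp_d hP hS.posDef_H hLip ht (memLp_xhat hxin hxbin) hδ
  have hmove : MemLp (fun ω => Z.xbin k (t + 1) ω - Z.x k ω) 2 μ :=
    memLp_two_of_sqNormW_le hS.posDef_H
      ((hR.stronglyMeasurable_xbin_succ (Finset.mem_Icc.1 ht).2).sub
        (hR.stronglyMeasurable_x k)).aestronglyMeasurable
      (((integrable_sqNormW S.H (hxbin.sub hk.x)).const_mul 2).add
        ((integrable_sqNormW S.H⁻¹ (hd.add (hk.memLp_h hresid))).const_mul _))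
      (.of_forall fun ω => sqNormW_sub_le_of_isMinOn hP.convex_X hS.posDef_H
        ((hR.updates ω).posSemidef_M hS.β_pos.le k) hγ ((hR.updates ω).xbin_succ k t ht).1
        ((hR.updates ω).mem_X hP (hR.x_zero_mem ω) k).1 ((hR.updates ω).xbin_succ k t ht).2)
  exact (hk.x.add hmove).ae_eq (.of_forall fun _ => add_sub_cancel _ _)

theorem IsRun.memLp_inner_succ (hR : Z.IsRun P S μ 𝓖) (hP : P.Standing) (hS : S.IsAdmissible)
    (hLip : P.GradLipschitz S.H ν) (hδ : ∀ t ∈ Finset.Icc 1 (S.m k), MemLp (Z.δ P k t) 2 μ)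
    (hresid : P.resid xs ys = 0) (hk : Z.SqIntegrable P S μ ys k) (ht : t ≤ S.m k) :
    MemLp (Z.xin k (t + 1)) 2 μ ∧ MemLp (Z.xbin k (t + 1)) 2 μ := by
  induction t with
  | zero =>
    rw [zero_add, funext fun ω => (hR.updates ω).xin_one k,
      funext fun ω => (hR.updates ω).xbin_one k]
    exact ⟨hk.x, hk.xb⟩
  | succ t ih =>
    obtain ⟨hxin, hxbin⟩ := ih (by omega)
    have hmem : t + 1 ∈ Finset.Icc 1 (S.m k) := Finset.mem_Icc.2 ⟨by omega, ht⟩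
    have hxbin' := hR.memLp_xbin_succ hP hS hLip hresid hk hmem hxin hxbin (hδ _ hmem)
    have hxin_succ : Z.xin k (t + 1 + 1)
        = (2 / (((t + 1 : ℕ) : ℝ) + 1)) • Z.xbin k (t + 1 + 1)
          + (1 - 2 / (((t + 1 : ℕ) : ℝ) + 1)) • Z.xin k (t + 1) :=
      funext fun ω => (hR.updates ω).xin_succ k (t + 1) hmem
    rw [hxin_succ]
    exact ⟨(hxbin'.const_smul _).add (hxin.const_smul _), hxbin'⟩

theorem IsRun.sqIntegrable_zero (hR : Z.IsRun P S μ 𝓖) (ys : Vec n₂) :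
    Z.SqIntegrable P S μ ys 0 := by
  obtain ⟨x₀, -, hx⟩ := hR.x_zero
  obtain ⟨y₀, -, hy⟩ := hR.y_zero
  obtain ⟨lam₀, hlam⟩ := hR.lam_zero
  have hxb (ω : Ω) : Z.xb 0 ω = x₀ := (hR.updates ω).xb_zero.trans (hx ω)
  constructor
  · exact funext hx ▸ memLp_const x₀
  · exact funext hxb ▸ memLp_const x₀
  · exact funext hlam ▸ memLp_const lam₀
  · simp only [hy, memLp_const]
  · simp only [hy, integrable_const]

theorem IsRun.memLp_lamHalf (hR : Z.IsRun P S μ 𝓖) (hresid : P.resid xs ys = 0)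
    (hk : Z.SqIntegrable P S μ ys k) (hx : MemLp (Z.x (k + 1)) 2 μ) :
    MemLp (Z.lamHalf k) 2 μ := by
  have hlamHalf : Z.lamHalf k = Z.lam k
      - (S.τ * S.β) • fun ω => P.resid (Z.x (k + 1) ω) (Z.y k ω) :=
    funext fun ω => (hR.updates ω).lamHalf_eq k
  rw [hlamHalf]
  exact hk.lam.sub ((memLp_resid hresid hx hk.act_B).const_smul (S.τ * S.β))

theorem IsRun.sqIntegrable_succ (hR : Z.IsRun P S μ 𝓖) (hP : P.Standing) (hS : S.IsAdmissible)
    (hLip : P.GradLipschitz S.H ν) (hδ : ∀ t ∈ Finset.Icc 1 (S.m k), MemLp (Z.δ P k t) 2 μ)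
    (hw : P.IsSaddlePoint xs ys ls) (hk : Z.SqIntegrable P S μ ys k) :
    Z.SqIntegrable P S μ ys (k + 1) := by
  have hresid := hw.resid_eq_zero hP
  obtain ⟨hx, hxb⟩ := hR.memLp_inner_succ hP hS hLip hδ hresid hk le_rfl
  rw [← funext fun ω => (hR.updates ω).x_succ k] at hx
  rw [← funext fun ω => (hR.updates ω).xb_succ k] at hxb
  have hlamHalf := hR.memLp_lamHalf hresid hk hx
  have hbound := (((hlamHalf.sub (memLp_const ls)).sub
    ((memLp_act P.A (hx.sub (memLp_const xs))).const_smul S.β)).integrable_norm_pow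
      two_ne_zero).const_mul (1 / S.β) |>.add hk.sqNormW_L
  have hle (ω : Ω) :=
    (hR.updates ω).norm_sq_act_B_add_sqNormW_L_le hP hS.β_pos hS.posSemidef_L hw k
  have hL_nonneg (ω : Ω) := sqNormW_nonneg hS.posSemidef_L (Z.y (k + 1) ω - ys)
  have hy : StronglyMeasurable (fun ω => Z.y (k + 1) ω - ys) :=
    (hR.stronglyMeasurable_y (k + 1)).sub stronglyMeasurable_const
  have hact_B : MemLp (fun ω => act P.B (Z.y (k + 1) ω - ys)) 2 μ := by
    refine memLp_two_of_norm_sq_le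
      ((continuous_act P.B).comp_stronglyMeasurable hy).aestronglyMeasurable
      (hbound.div_const S.β) (.of_forall fun ω => ?_)
    rw [le_div_iff₀' hS.β_pos]
    exact (le_add_of_nonneg_right (hL_nonneg ω)).trans (hle ω)
  refine ⟨hx, hxb, ?_, hact_B, hbound.mono'
    ((continuous_sqNormW S.L).comp_stronglyMeasurable hy).aestronglyMeasurable
    (.of_forall fun ω => ?_)⟩
  · have hlam : Z.lam (k + 1) = Z.lamHalf k
        - (S.s * S.β) • fun ω => P.resid (Z.x (k + 1) ω) (Z.y (k + 1) ω) :=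
      funext fun ω => (hR.updates ω).lam_succ k
    rw [hlam]
    exact hlamHalf.sub ((memLp_resid hresid hx hact_B).const_smul (S.s * S.β))
  · rw [Real.norm_of_nonneg (hL_nonneg ω)]
    exact (le_add_of_nonneg_left (mul_nonneg hS.β_pos.le (sq_nonneg _))).trans (hle ω)

theorem IsRun.sqIntegrable (hR : Z.IsRun P S μ 𝓖) (hP : P.Standing) (hS : S.IsAdmissible)
    (hLip : P.GradLipschitz S.H ν)
    (hδ : ∀ k, ∀ t ∈ Finset.Icc 1 (S.m k), MemLp (Z.δ P k t) 2 μ)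
    (hw : P.IsSaddlePoint xs ys ls) (k : ℕ) : Z.SqIntegrable P S μ ys k := by
  induction k with
  | zero => exact hR.sqIntegrable_zero ys
  | succ k hk => exact hR.sqIntegrable_succ hP hS hLip (hδ k) hw hk

end Integrability

section Unbiasedness

variable [IsFiniteMeasure μ] {ν : ℝ}

theorem IsRun.memLp_gradient_ξ (hR : Z.IsRun P S μ 𝓖) (hP : P.Standing) (hH : S.H.PosDef)
    (hLip : P.GradLipschitz S.H ν) (ht : t ∈ Finset.Icc 1 (S.m k))
    (hxhat : MemLp (Z.xhat k t) 2 μ) :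
    MemLp (fun ω => gradient (P.fj (Z.ξ k t ω)) (Z.xhat k t ω)) 2 μ := by
  obtain ⟨x₀, hx₀, -⟩ := hR.x_zero
  have hgrad (j : Fin N) := hLip.memLp_gradient_fj hH hxhat
    (fun ω => (hR.updates ω).xhat_mem hP (hR.x_zero_mem ω) ht) hx₀ j
  refine (memLp_finsetSum Finset.univ fun j _ => (hgrad j).norm).mono'
    (hR.sampling.measurable_gradient_ξ P ht).aestronglyMeasurable (.of_forall fun ω => ?_)
  exact Finset.single_le_sum (f := fun j => ‖gradient (P.fj j) (Z.xhat k t ω)‖)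
    (fun _ _ => norm_nonneg _) (Finset.mem_univ _)

theorem IsRun.integral_inner_gradient_ξ (hR : Z.IsRun P S μ 𝓖) (hP : P.Standing)
    (hH : S.H.PosDef) (hLip : P.GradLipschitz S.H ν) (ht : t ∈ Finset.Icc 1 (S.m k))
    (hxhat : MemLp (Z.xhat k t) 2 μ) {W : Ω → Vec n₁}
    (hW : StronglyMeasurable[𝓖 (toLex (k, t - 1))] W) (hW_memLp : MemLp W 2 μ) :
    ∫ ω, ⟪gradient (P.fj (Z.ξ k t ω)) (Z.xhat k t ω), W ω⟫ ∂μ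
      = ∫ ω, ⟪gradient P.f (Z.xhat k t ω), W ω⟫ ∂μ := by
  obtain ⟨x₀, hx₀, -⟩ := hR.x_zero
  have hmem (ω : Ω) : Z.xhat k t ω ∈ P.X := (hR.updates ω).xhat_mem hP (hR.x_zero_mem ω) ht
  have hint (j : Fin N) : Integrable (fun ω => ⟪gradient (P.fj j) (Z.xhat k t ω), W ω⟫) μ :=
    integrable_inner_of_memLp (hLip.memLp_gradient_fj hH hxhat hmem hx₀ j) hW_memLp
  have hmeas (j : Fin N) : Measurable[𝓖 (toLex (k, t - 1))]
      (fun ω => ⟪gradient (P.fj j) (Z.xhat k t ω), W ω⟫) :=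
    (StronglyMeasurable.inner ((measurable_gradient (P.fj j)).comp
      (hR.sampling.stronglyMeasurable_xhat ht).measurable).stronglyMeasurable hW).measurable
  rw [integral_apply_of_indep (hR.sampling.measurable_ξ ht) (hR.sampling.ξ_indep k t ht)
    (V := fun j ω => ⟪gradient (P.fj j) (Z.xhat k t ω), W ω⟫) hmeas hint]
  simp_rw [fun ω => hP.gradient_f (hmem ω), real_inner_smul_left, sum_inner]
  rw [integral_const_mul, integral_finsetSum _ fun j _ => hint j, Finset.mul_sum]
  exact Finset.sum_congr rfl fun j _ => congrArg (· * _) (hR.sampling.ξ_unif k t ht j)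

theorem IsRun.integral_inner_δ (hR : Z.IsRun P S μ 𝓖) (hP : P.Standing) (hH : S.H.PosDef)
    (hLip : P.GradLipschitz S.H ν) (ht : t ∈ Finset.Icc 1 (S.m k))
    (hxhat : MemLp (Z.xhat k t) 2 μ) (hδ : MemLp (Z.δ P k t) 2 μ) {W : Ω → Vec n₁}
    (hW : StronglyMeasurable[𝓖 (toLex (k, t - 1))] W) (hW_memLp : MemLp W 2 μ) :
    ∫ ω, ⟪Z.δ P k t ω, W ω⟫ ∂μ = 0 := by
  have hgrad := hR.memLp_gradient_xhat hP hH hLip ht hxhat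
  have hgrad_ξ := hR.memLp_gradient_ξ hP hH hLip ht hxhat
  have he : MemLp (Z.e k t) 2 μ :=
    ((hR.memLp_d hP hH hLip ht hxhat hδ).sub hgrad_ξ).ae_eq
      (.of_forall fun _ => add_sub_cancel_left _ _)
  have hgradW := integrable_inner_of_memLp hgrad hW_memLp
  have hgrad_ξW := integrable_inner_of_memLp hgrad_ξ hW_memLp
  have heW := integrable_inner_of_memLp he hW_memLp
  have he_mean := integral_inner_eq_zero_of_condExp_eq_zero (𝓖.le _)
    (hR.sampling.e_int k t ht) (hR.sampling.e_mean k t ht) hW heW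
  simp_rw [δ, d, ← sub_sub, inner_sub_left]
  rw [integral_sub (by exact hgradW.sub hgrad_ξW) heW, integral_sub hgradW hgrad_ξW, he_mean,
    hR.integral_inner_gradient_ξ hP hH hLip ht hxhat hW hW_memLp, sub_self, sub_zero]

end Unbiasedness

end Trajectory

section Rates

theorem isBigO_div_of_abs_le {q s r : ℕ → ℝ} {K C : ℝ}
    (hq : ∀ T : ℕ, |q T| ≤ 1 / ((T : ℝ) + 1) * (K + C * s T)) (hs : s =O[atTop] r)
    (hr : (fun _ => (1 : ℝ)) =O[atTop] r) : q =O[atTop] (fun T : ℕ => r T / (T : ℝ)) := by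
  have hbound : q =O[atTop] (fun T : ℕ => (K + C * s T) / (T : ℝ)) := by
    refine IsBigO.of_bound' ?_
    filter_upwards [eventually_gt_atTop 0] with T hT
    have : (0 : ℝ) < T := by exact_mod_cast hT
    calc ‖q T‖ ≤ 1 / ((T : ℝ) + 1) * (K + C * s T) := hq T
      _ ≤ 1 / ((T : ℝ) + 1) * |K + C * s T| := by gcongr; exact le_abs_self _
      _ ≤ 1 / (T : ℝ) * |K + C * s T| := by gcongr; linarith
      _ = ‖(K + C * s T) / (T : ℝ)‖ := by
        rw [norm_div, Real.norm_natCast, Real.norm_eq_abs, one_div_mul_eq_div]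
  have hK : (fun _ : ℕ => K) =O[atTop] r := (isBigO_const_const K one_ne_zero _).trans hr
  refine hbound.trans ?_
  simp_rw [div_eq_mul_inv]
  exact (hK.add (hs.const_mul_left C)).mul (isBigO_refl _ _)

theorem isBigO_sum_Icc_one_of_summable {a : ℕ → ℝ} (ha : Summable a) (ha₀ : ∀ k, 0 ≤ a k)
    (κ : ℕ) : (fun T : ℕ => ∑ k ∈ Finset.Icc κ (κ + T), a k) =O[atTop] (fun _ => (1 : ℝ)) := by
  refine IsBigO.of_bound (∑' k, a k) (.of_forall fun T => ?_)
  rw [norm_one, mul_one, Real.norm_of_nonneg (Finset.sum_nonneg fun k _ => ha₀ k)]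
  exact ha.sum_le_tsum _ fun k _ => ha₀ k

theorem isBigO_one_log_natCast : (fun _ : ℕ => (1 : ℝ)) =O[atTop] (fun T : ℕ => Real.log T) :=
  ((Real.isLittleO_const_log_atTop (c := 1)).comp_tendsto tendsto_natCast_atTop_atTop).isBigO

theorem sum_Icc_one_div_le_one_add_log {κ : ℕ} (hκ : 0 < κ) (M : ℕ) :
    ∑ k ∈ Finset.Icc κ M, 1 / (k : ℝ) ≤ 1 + Real.log M := by
  have hharmonic := harmonic_le_one_add_log M
  rw [harmonic_eq_sum_Icc] at hharmonic
  push_cast at hharmonic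
  simp only [one_div]
  exact (Finset.sum_le_sum_of_subset_of_nonneg (Finset.Icc_subset_Icc_left hκ)
    fun _ _ _ => by positivity).trans hharmonic

theorem isBigO_sum_Icc_log {a : ℕ → ℝ} {c : ℝ} {κ : ℕ} (hκ : 0 < κ) (ha₀ : ∀ k, 0 ≤ a k)
    (ha : ∀ k ≥ κ, a k ≤ c * (1 / (k : ℝ))) :
    (fun T : ℕ => ∑ k ∈ Finset.Icc κ (κ + T), a k) =O[atTop] (fun T : ℕ => Real.log T) := by
  have hc : 0 ≤ c := by
    by_contra! hc
    have hκ' : 0 < 1 / (κ : ℝ) := one_div_pos.2 (by exact_mod_cast hκ)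
    linarith [ha κ le_rfl, ha₀ κ, mul_neg_of_neg_of_pos hc hκ']
  have hbound : (fun T : ℕ => ∑ k ∈ Finset.Icc κ (κ + T), a k)
      =O[atTop] (fun T : ℕ => 1 + 2 * Real.log T) := by
    refine IsBigO.of_bound c ?_
    filter_upwards [eventually_ge_atTop (max 2 κ)] with T hT
    obtain ⟨hT₂, hTκ⟩ := max_le_iff.1 hT
    have hlog : Real.log ((κ + T : ℕ) : ℝ) ≤ 2 * Real.log T := by
      rw [← Nat.cast_ofNat, ← Real.log_pow]
      refine Real.log_le_log (by positivity) ?_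
      exact_mod_cast (show κ + T ≤ T ^ 2 by nlinarith)
    have hsum := sum_Icc_one_div_le_one_add_log hκ (κ + T)
    rw [Real.norm_of_nonneg (Finset.sum_nonneg fun k _ => ha₀ k)]
    calc ∑ k ∈ Finset.Icc κ (κ + T), a k
        ≤ c * ∑ k ∈ Finset.Icc κ (κ + T), 1 / (k : ℝ) := by
          rw [Finset.mul_sum]
          exact Finset.sum_le_sum fun k hk => ha k (Finset.mem_Icc.1 hk).1
      _ ≤ c * (1 + 2 * Real.log T) := by gcongr; linarith
      _ ≤ c * ‖1 + 2 * Real.log T‖ := by gcongr; exact Real.le_norm_self _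
  exact hbound.trans (isBigO_one_log_natCast.add ((isBigO_refl _ _).const_mul_left 2))

end Rates

namespace Params

variable {n₁ n₂ : ℕ} {S : Params n₁ n₂} {c₁ c₂ c₃ ϱ : ℝ} {m : ℕ}

theorem monotone_m (hc₃ : 0 ≤ c₃) (hϱ : 0 ≤ ϱ)
    (hmk : ∀ k : ℕ, S.m k = max ⌈c₃ * (k : ℝ) ^ ϱ⌉₊ m) : Monotone S.m := by
  intro j k hjk
  rw [hmk, hmk]
  gcongr

theorem one_div_m_le (hc₃ : 0 < c₃)
    (hmk : ∀ k : ℕ, S.m k = max ⌈c₃ * (k : ℝ) ^ ϱ⌉₊ m) {k : ℕ} (hk : 0 < k) :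
    1 / (S.m k : ℝ) ≤ 1 / c₃ * (1 / (k : ℝ) ^ ϱ) := by
  have : 0 < (k : ℝ) ^ ϱ := Real.rpow_pos_of_pos (by exact_mod_cast hk) _
  have hm : c₃ * (k : ℝ) ^ ϱ ≤ S.m k := by
    rw [hmk]
    exact (Nat.le_ceil _).trans (by exact_mod_cast le_max_left _ _)
  rw [one_div_mul_one_div]
  gcongr

theorem summable_one_div_m (hc₃ : 0 < c₃) (hϱ : 1 < ϱ)
    (hmk : ∀ k : ℕ, S.m k = max ⌈c₃ * (k : ℝ) ^ ϱ⌉₊ m) : Summable fun k => 1 / (S.m k : ℝ) := by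
  refine ((Real.summable_one_div_nat_rpow.2 hϱ).mul_left (1 / c₃)).of_norm_bounded_eventually_nat ?_
  filter_upwards [eventually_gt_atTop 0] with k hk
  rw [Real.norm_of_nonneg (by positivity)]
  exact one_div_m_le hc₃ hmk hk

theorem antitone_weight (hc₁ : 0 < c₁) (hc₂ : 0 < c₂) (hm : ∀ k, 0 < S.m k) (hmono : Monotone S.m)
    (hηk : ∀ k : ℕ, S.η k = min (c₁ / ((S.m k : ℝ) * ((S.m k : ℝ) + 1))) c₂) :
    Antitone S.weight := by
  have hm' (k : ℕ) : (0 : ℝ) < S.m k := by exact_mod_cast hm k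
  have hweight (k : ℕ) : S.weight k = 2 / min c₁ ((S.m k : ℝ) * ((S.m k : ℝ) + 1) * c₂) := by
    have := hm' k
    rw [weight, hηk, mul_min_of_nonneg _ _ (by positivity), mul_div_cancel₀ _ (by positivity)]
  intro j k hjk
  have hj := hm' j
  rw [hweight, hweight]
  have hle : (S.m j : ℝ) ≤ S.m k := by exact_mod_cast hmono hjk
  gcongr

theorem isAdmissible_of_m_eq_of_η_eq (hβ : 0 < S.β) (hH : S.H.PosDef) (hL : S.L.PosSemidef)
    (hΔ : (S.τ, S.s) ∈ Delta) (hc₁ : 0 < c₁) (hc₂ : 0 < c₂) (hc₃ : 0 ≤ c₃) (hϱ : 0 ≤ ϱ)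
    (hm : 0 < m) (hmk : ∀ k : ℕ, S.m k = max ⌈c₃ * (k : ℝ) ^ ϱ⌉₊ m)
    (hηk : ∀ k : ℕ, S.η k = min (c₁ / ((S.m k : ℝ) * ((S.m k : ℝ) + 1))) c₂) :
    S.IsAdmissible := by
  have hm_pos (k : ℕ) : 0 < S.m k := by
    rw [hmk]
    exact lt_max_of_lt_right hm
  refine ⟨hβ, hH, hL, hΔ, hm_pos, fun k => ?_,
    antitone_weight hc₁ hc₂ hm_pos (monotone_m hc₃ hϱ hmk) hηk⟩
  have : (0 : ℝ) < S.m k := by exact_mod_cast hm_pos k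
  rw [hηk]
  exact lt_min (by positivity) hc₂

end Params

theorem two_div_mul_sum_sq_mul_le {M : ℕ} (hM : 0 < M) {η c V : ℝ} (hη₀ : 0 ≤ η)
    (hη : η ≤ c / ((M : ℝ) * (M + 1))) (hV : 0 ≤ V) {v : ℕ → ℝ}
    (hv : ∀ t ∈ Finset.Icc 1 M, v t ≤ V) :
    2 / ((M : ℝ) * (M + 1)) * ∑ t ∈ Finset.Icc 1 M, η / 2 * ((t : ℝ) ^ 2 * v t)
      ≤ c * V * (1 / (M : ℝ)) := by
  have hM₀ : (0 : ℝ) < M := by exact_mod_cast hM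
  have hηc : η * ((M : ℝ) * (M + 1)) ≤ c := (le_div_iff₀ (by positivity)).1 hη
  have hc : 0 ≤ c := le_trans (by positivity) hηc
  have hsum : ∑ t ∈ Finset.Icc 1 M, η / 2 * ((t : ℝ) ^ 2 * v t)
      ≤ M * (η / 2 * ((M : ℝ) ^ 2 * V)) := by
    refine (Finset.sum_le_card_nsmul _ _ (η / 2 * ((M : ℝ) ^ 2 * V)) fun t ht => ?_).trans_eq
      (by simp)
    have htM : (t : ℝ) ≤ M := by exact_mod_cast (Finset.mem_Icc.1 ht).2
    have htv := hv t ht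
    calc η / 2 * ((t : ℝ) ^ 2 * v t) ≤ η / 2 * ((t : ℝ) ^ 2 * V) := by gcongr
      _ ≤ η / 2 * ((M : ℝ) ^ 2 * V) := by gcongr
  calc 2 / ((M : ℝ) * (M + 1)) * ∑ t ∈ Finset.Icc 1 M, η / 2 * ((t : ℝ) ^ 2 * v t)
      ≤ 2 / ((M : ℝ) * (M + 1)) * (M * (η / 2 * ((M : ℝ) ^ 2 * V))) := by gcongr
    _ = η * ((M : ℝ) * (M + 1)) * V * (M / ((M + 1) * (M + 1))) := by field_simp
    _ ≤ c * V * (M / ((M + 1) * (M + 1))) := by gcongr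
    _ ≤ c * V * (1 / (M : ℝ)) := by
      refine mul_le_mul_of_nonneg_left ?_ (by positivity)
      rw [div_le_div_iff₀ (by positivity) hM₀]
      nlinarith

theorem sqNormW_sub_le {q : ℕ} {G : Matrix (Fin q) (Fin q) ℝ} (hG : G.PosSemidef)
    (u v : Vec q) : sqNormW G (u - v) ≤ 2 * sqNormW G u + 2 * sqNormW G v := by
  have hadd := sqNormW_nonneg hG (u + v)
  rw [sqNormW_add hG.isHermitian] at hadd
  rw [sqNormW_sub hG.isHermitian]
  linarith

theorem norm_sub_sq_le_of_norm_le {E : Type*} [SeminormedAddCommGroup E] {u v : E} {ρ : ℝ}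
    (hv : ‖v‖ ≤ ρ) : ‖u - v‖ ^ 2 ≤ 2 * ‖u‖ ^ 2 + 2 * ρ ^ 2 := by
  have hle : ‖u - v‖ ≤ ‖u‖ + ρ := (norm_sub_le u v).trans (by gcongr)
  calc ‖u - v‖ ^ 2 ≤ (‖u‖ + ρ) ^ 2 := by gcongr
    _ ≤ 2 * ‖u‖ ^ 2 + 2 * ρ ^ 2 := by linarith [add_sq_le (a := ‖u‖) (b := ρ)]

theorem integrable_and_norm_integral_le {Ω E : Type*} [MeasurableSpace Ω] {μ : Measure Ω}
    [NormedAddCommGroup E] [NormedSpace ℝ E] {X : Ω → E} {U : Ω → ℝ} {C : ℝ}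
    (hX : AEStronglyMeasurable X μ) (hU : Integrable U μ) (hXU : ∀ ω, ‖X ω‖ ≤ U ω)
    (hC : ∫ ω, U ω ∂μ ≤ C) : Integrable X μ ∧ ‖∫ ω, X ω ∂μ‖ ≤ C :=
  ⟨hU.mono' hX (.of_forall hXU), (norm_integral_le_of_norm_le hU (.of_forall hXU)).trans hC⟩

namespace Trajectory

variable {n n₁ n₂ N : ℕ} {Ω : Type*} [MeasurableSpace Ω] {Z : Trajectory n n₁ n₂ N Ω}
  {P : Problem n n₁ n₂ N} {S : Params n₁ n₂} {μ : Measure Ω}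
  {𝓖 : Filtration (ℕ ×ₗ ℕ) (inferInstance : MeasurableSpace Ω)}
  {ν : ℝ} {xs : Vec n₁} {ys : Vec n₂} {ls : Vec n} {k t : ℕ}

section Noise

variable [IsFiniteMeasure μ]

theorem IsRun.memLp_inner (hR : Z.IsRun P S μ 𝓖) (hP : P.Standing) (hS : S.IsAdmissible)
    (hLip : P.GradLipschitz S.H ν)
    (hδ : ∀ k, ∀ t ∈ Finset.Icc 1 (S.m k), MemLp (Z.δ P k t) 2 μ)
    (hw : P.IsSaddlePoint xs ys ls) (ht : t ∈ Finset.Icc 1 (S.m k)) :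
    MemLp (Z.xin k t) 2 μ ∧ MemLp (Z.xbin k t) 2 μ := by
  obtain ⟨ht₁, htm⟩ := Finset.mem_Icc.1 ht
  obtain ⟨u, rfl⟩ := Nat.exists_eq_add_of_le' ht₁
  exact hR.memLp_inner_succ hP hS hLip (hδ k) (hw.resid_eq_zero hP)
    (hR.sqIntegrable hP hS hLip hδ hw k) (by omega)

theorem integrable_stepNoise (hxbin : MemLp (Z.xbin k t) 2 μ) (hδ : MemLp (Z.δ P k t) 2 μ)
    (x : Vec n₁) : Integrable (Z.stepNoise P S x k t) μ :=
  ((integrable_inner_of_memLp hδ (hxbin.sub (memLp_const x))).const_mul (t : ℝ)).add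
    (((integrable_sqNormW S.H⁻¹ hδ).const_mul _).const_mul _)

theorem IsRun.integral_stepNoise (hR : Z.IsRun P S μ 𝓖) (hP : P.Standing) (hH : S.H.PosDef)
    (hLip : P.GradLipschitz S.H ν) (ht : t ∈ Finset.Icc 1 (S.m k))
    (hxin : MemLp (Z.xin k t) 2 μ) (hxbin : MemLp (Z.xbin k t) 2 μ)
    (hδ : MemLp (Z.δ P k t) 2 μ) (x : Vec n₁) :
    ∫ ω, Z.stepNoise P S x k t ω ∂μ
      = S.η k / 2 * ((t : ℝ) ^ 2 * ∫ ω, sqNormW S.H⁻¹ (Z.δ P k t ω) ∂μ) := by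
  have hmove : MemLp (fun ω => Z.xbin k t ω - x) 2 μ := hxbin.sub (memLp_const x)
  have hunbiased : ∫ ω, ⟪Z.δ P k t ω, Z.xbin k t ω - x⟫ ∂μ = 0 :=
    hR.integral_inner_δ hP hH hLip ht (memLp_xhat hxin hxbin) hδ
      ((hR.sampling.xbin_meas k t ht).sub stronglyMeasurable_const) hmove
  unfold stepNoise
  rw [integral_add ((integrable_inner_of_memLp hδ hmove).const_mul _)
    (((integrable_sqNormW S.H⁻¹ hδ).const_mul _).const_mul _), integral_const_mul,
    integral_const_mul, integral_const_mul, hunbiased, mul_zero, zero_add]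

theorem IsRun.integrable_noise (hR : Z.IsRun P S μ 𝓖) (hP : P.Standing) (hS : S.IsAdmissible)
    (hLip : P.GradLipschitz S.H ν)
    (hδ : ∀ k, ∀ t ∈ Finset.Icc 1 (S.m k), MemLp (Z.δ P k t) 2 μ)
    (hw : P.IsSaddlePoint xs ys ls) (k : ℕ) (x : Vec n₁) :
    Integrable (Z.noise P S x k) μ :=
  (integrable_finsetSum _ fun t ht => integrable_stepNoise
    (hR.memLp_inner hP hS hLip hδ hw ht).2 (hδ k t ht) x).const_mul _

theorem IsRun.integral_noise_le (hR : Z.IsRun P S μ 𝓖) (hP : P.Standing) (hS : S.IsAdmissible)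
    (hLip : P.GradLipschitz S.H ν)
    (hδ : ∀ k, ∀ t ∈ Finset.Icc 1 (S.m k), MemLp (Z.δ P k t) 2 μ)
    (hw : P.IsSaddlePoint xs ys ls) {c V : ℝ} (hη : S.η k ≤ c / ((S.m k : ℝ) * (S.m k + 1)))
    (hV : 0 ≤ V)
    (hδV : ∀ t ∈ Finset.Icc 1 (S.m k), ∫ ω, sqNormW S.H⁻¹ (Z.δ P k t ω) ∂μ ≤ V) (x : Vec n₁) :
    ∫ ω, Z.noise P S x k ω ∂μ ≤ c * V * (1 / (S.m k : ℝ)) := by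
  have hinner (t : ℕ) (ht : t ∈ Finset.Icc 1 (S.m k)) := hR.memLp_inner hP hS hLip hδ hw ht
  unfold noise
  rw [integral_const_mul, integral_finsetSum _ fun t ht =>
      integrable_stepNoise (hinner t ht).2 (hδ k t ht) x,
    Finset.sum_congr rfl fun t ht => hR.integral_stepNoise hP hS.posDef_H hLip ht (hinner t ht).1
      (hinner t ht).2 (hδ k t ht) x]
  exact two_div_mul_sum_sq_mul_le (hS.m_pos k) (hS.η_pos k).le hη hV hδV

end Noise

section InitialPotential

variable [IsFiniteMeasure μ]

/-- The bound is uniform in the multiplier so that it survives maximizing the Lagrangian gap over a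
ball of multipliers before taking expectations. -/
theorem exists_integrable_potential_le (hβ : 0 ≤ S.β) (hL : S.L.PosSemidef)
    (hΔ : (S.τ, S.s) ∈ Delta) (hresid : P.resid xs ys = 0) {κ : ℕ}
    (hM : ∃ R : ℝ, ∀ ω, (R • (1 : Matrix (Fin n₁) (Fin n₁) ℝ) - Z.M κ ω).PosSemidef)
    (hcur : Z.SqIntegrable P S μ ys κ) (hprev : Z.SqIntegrable P S μ ys (κ - 1)) (ρ : ℝ) :
    ∃ Φ : Ω → ℝ, Integrable Φ μ ∧
      ∀ ω, ∀ l : Vec n, ‖l‖ ≤ ρ → Z.potential P S xs ys l κ ω ≤ Φ ω := by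
  obtain ⟨R, hM⟩ := hM
  obtain ⟨C, hC, hdual⟩ := exists_dualForm_le (E := Vec n) S.β S.τ S.s
  have hτ := one_add_pos_of_mem_Delta hΔ
  have hτ₁ : 0 ≤ 1 - S.τ := sub_nonneg.2 hΔ.2.1
  refine ⟨fun ω => C * (‖act P.B (Z.y κ ω - ys)‖ ^ 2 + (2 * ‖Z.lam κ ω‖ ^ 2 + 2 * ρ ^ 2))
    + 1 / 2 * sqNormW S.L (Z.y κ ω - ys)
    + 1 / 2 * (R * ‖Z.x κ ω - xs‖ ^ 2)
    + S.β / 2 * ((1 - S.s) ^ 2 / (1 + S.τ)) * ‖P.resid (Z.x κ ω) (Z.y κ ω)‖ ^ 2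
    + (1 - S.τ) / (1 + S.τ) / 2 * (2 * sqNormW S.L (Z.y κ ω - ys)
      + 2 * sqNormW S.L (Z.y (κ - 1) ω - ys))
    + S.weight κ * sqNormW S.H (Z.xb κ ω - xs), ?_, fun ω l hl => ?_⟩
  · have hq := hcur.act_B.integrable_norm_pow two_ne_zero
    have hlam := hcur.lam.integrable_norm_pow two_ne_zero
    have hx := (hcur.x.sub (memLp_const xs)).integrable_norm_pow two_ne_zero
    have hr := (memLp_resid hresid hcur.x hcur.act_B).integrable_norm_pow two_ne_zero
    have hxb := integrable_sqNormW S.H (hcur.xb.sub (memLp_const xs))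
    exact ((((((hq.add ((hlam.const_mul 2).add (integrable_const _))).const_mul C).add
      (hcur.sqNormW_L.const_mul _)).add ((hx.const_mul R).const_mul _)).add
      (hr.const_mul _)).add (((hcur.sqNormW_L.const_mul 2).add
      (hprev.sqNormW_L.const_mul 2)).const_mul _)).add (hxb.const_mul _)
  · have hdual_le : dualForm S.β S.τ S.s (act P.B (Z.y κ ω - ys)) (Z.lam κ ω - l)
        ≤ C * (‖act P.B (Z.y κ ω - ys)‖ ^ 2 + (2 * ‖Z.lam κ ω‖ ^ 2 + 2 * ρ ^ 2)) :=
      (hdual _ _).trans (by gcongr; exact norm_sub_sq_le_of_norm_le hl)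
    have hD_le := sqNormW_D_le (P := P) hβ (hM ω) (Z.x κ ω - xs)
    have hL_le := sqNormW_sub_le hL (Z.y κ ω - ys) (Z.y (κ - 1) ω - ys)
    rw [sub_sub_sub_cancel_right] at hL_le
    have hL_scaled := mul_le_mul_of_nonneg_left hL_le
      (by positivity : 0 ≤ (1 - S.τ) / (1 + S.τ) / 2)
    unfold potential
    linarith

end InitialPotential

section ErgodicMeasurability

theorem IsRun.stronglyMeasurable_xErg (hR : Z.IsRun P S μ 𝓖) (κ T : ℕ) :
    StronglyMeasurable (Z.xErg κ T) :=
  (Finset.stronglyMeasurable_fun_sum _ fun k _ => hR.stronglyMeasurable_x (k + 1)).const_smul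
    (1 / ((T : ℝ) + 1))

theorem IsRun.stronglyMeasurable_yErg (hR : Z.IsRun P S μ 𝓖) (κ T : ℕ) :
    StronglyMeasurable (Z.yErg κ T) :=
  (Finset.stronglyMeasurable_fun_sum _ fun k _ => hR.stronglyMeasurable_y (k + 1)).const_smul
    (1 / ((T : ℝ) + 1))

theorem IsRun.stronglyMeasurable_resid_erg (hR : Z.IsRun P S μ 𝓖) (κ T : ℕ) :
    StronglyMeasurable (fun ω => P.resid (Z.xErg κ T ω) (Z.yErg κ T ω)) :=
  (((continuous_act P.A).comp_stronglyMeasurable (hR.stronglyMeasurable_xErg κ T)).add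
    ((continuous_act P.B).comp_stronglyMeasurable (hR.stronglyMeasurable_yErg κ T))).sub
      stronglyMeasurable_const

theorem IsRun.measurable_objective_erg (hR : Z.IsRun P S μ 𝓖) (hP : P.Standing) (κ T : ℕ) :
    Measurable (fun ω => P.f (Z.xErg κ T ω) + P.gReal (Z.yErg κ T ω)) := by
  have hf : Measurable (fun ω => P.f (Z.xErg κ T ω)) :=
    (continuousOn_iff_continuous_domRestrict.1 hP.continuousOn_f).measurable.comp
      ((hR.stronglyMeasurable_xErg κ T).measurable.subtype_mk
        (h := fun ω => (hR.updates ω).xErg_mem hP (hR.x_zero_mem ω) κ T))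
  have hg : Measurable (fun ω => P.gReal (Z.yErg κ T ω)) :=
    hP.meas_g.ereal_toReal.comp ((hR.stronglyMeasurable_yErg κ T).measurable.subtype_mk
      (h := fun ω => ((hR.updates ω).yErg_mem hP κ T).1))
  exact hf.add hg

end ErgodicMeasurability

section Expectation

variable [IsFiniteMeasure μ] {κ : ℕ}

theorem IsRun.integrable_and_integral_ergodic_bound_le (hR : Z.IsRun P S μ 𝓖) (hP : P.Standing)
    (hS : S.IsAdmissible) (hLip : P.GradLipschitz S.H ν)
    (hδ : ∀ k, ∀ t ∈ Finset.Icc 1 (S.m k), MemLp (Z.δ P k t) 2 μ)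
    (hw : P.IsSaddlePoint xs ys ls) {c V : ℝ}
    (hη : ∀ k ≥ κ, S.η k ≤ c / ((S.m k : ℝ) * (S.m k + 1))) (hV : 0 ≤ V)
    (hδV : ∀ k ≥ κ, ∀ t ∈ Finset.Icc 1 (S.m k), ∫ ω, sqNormW S.H⁻¹ (Z.δ P k t ω) ∂μ ≤ V)
    {Φ : Ω → ℝ} (hΦ : Integrable Φ μ) (T : ℕ) :
    Integrable (fun ω => 1 / ((T : ℝ) + 1)
        * (Φ ω + ∑ k ∈ Finset.Icc κ (κ + T), Z.noise P S xs k ω)) μ ∧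
      ∫ ω, 1 / ((T : ℝ) + 1) * (Φ ω + ∑ k ∈ Finset.Icc κ (κ + T), Z.noise P S xs k ω) ∂μ
        ≤ 1 / ((T : ℝ) + 1)
          * ((∫ ω, Φ ω ∂μ) + c * V * ∑ k ∈ Finset.Icc κ (κ + T), 1 / (S.m k : ℝ)) := by
  have hnoise (k : ℕ) (_ : k ∈ Finset.Icc κ (κ + T)) : Integrable (Z.noise P S xs k) μ :=
    hR.integrable_noise hP hS hLip hδ hw k xs
  refine ⟨(hΦ.add (integrable_finsetSum _ hnoise)).const_mul _, ?_⟩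
  rw [integral_const_mul, integral_add hΦ (integrable_finsetSum _ hnoise),
    integral_finsetSum _ hnoise, Finset.mul_sum _ _ (c * V)]
  gcongr with k hk
  have hκk := (Finset.mem_Icc.1 hk).1
  exact hR.integral_noise_le hP hS hLip hδ hw (hη k hκk) hV (hδV k hκk) xs

theorem IsRun.exists_abs_integral_ergodic_le (hR : Z.IsRun P S μ 𝓖) (hP : P.Standing)
    (hS : S.IsAdmissible) (hν : 0 < ν) (hLip : P.GradLipschitz S.H ν) (hκ : 0 < κ)
    (hην : ∀ k ≥ κ, S.η k ≤ 1 / (2 * ν))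
    (hD : ∀ k ≥ κ, ∀ ω, (Z.D P S k ω - Z.D P S (k + 1) ω).PosSemidef)
    (hM : ∃ R : ℝ, ∀ ω, (R • (1 : Matrix (Fin n₁) (Fin n₁) ℝ) - Z.M κ ω).PosSemidef)
    (hδ : ∀ k, ∀ t ∈ Finset.Icc 1 (S.m k), MemLp (Z.δ P k t) 2 μ) {c V : ℝ}
    (hη : ∀ k ≥ κ, S.η k ≤ c / ((S.m k : ℝ) * (S.m k + 1))) (hV : 0 ≤ V)
    (hδV : ∀ k ≥ κ, ∀ t ∈ Finset.Icc 1 (S.m k), ∫ ω, sqNormW S.H⁻¹ (Z.δ P k t ω) ∂μ ≤ V)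
    (hw : P.IsSaddlePoint xs ys ls) :
    ∃ K C : ℝ, ∀ T : ℕ,
      (Integrable (fun ω => P.f (Z.xErg κ T ω) + P.gReal (Z.yErg κ T ω)) μ ∧
        |∫ ω, (P.f (Z.xErg κ T ω) + P.gReal (Z.yErg κ T ω) - (P.f xs + P.gReal ys)) ∂μ|
          ≤ 1 / ((T : ℝ) + 1) * (K + C * ∑ k ∈ Finset.Icc κ (κ + T), 1 / (S.m k : ℝ))) ∧
      (Integrable (fun ω => ‖P.resid (Z.xErg κ T ω) (Z.yErg κ T ω)‖) μ ∧
        |∫ ω, ‖P.resid (Z.xErg κ T ω) (Z.yErg κ T ω)‖ ∂μ|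
          ≤ 1 / ((T : ℝ) + 1) * (K + C * ∑ k ∈ Finset.Icc κ (κ + T), 1 / (S.m k : ℝ))) := by
  have hsq := hR.sqIntegrable hP hS hLip hδ hw
  obtain ⟨Φ, hΦ, hpot⟩ := exists_integrable_potential_le hS.β_pos.le hS.posSemidef_L
    hS.mem_Delta (hw.resid_eq_zero hP) hM (hsq κ) (hsq (κ - 1)) (‖ls‖ + 1)
  refine ⟨(‖ls‖ + 1) * ∫ ω, Φ ω ∂μ, (‖ls‖ + 1) * (c * V), fun T => ?_⟩
  obtain ⟨hbound, hbound_le⟩ :=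
    hR.integrable_and_integral_ergodic_bound_le hP hS hLip hδ hw hη hV hδV hΦ T
  have hpath (ω : Ω) := (hR.updates ω).ergodic_le hP hS (hR.x_zero_mem ω) hν hLip hκ hην
    (fun k hk => hD k hk ω) hw (hpot ω) T
  have hmajorant := hbound.const_mul (‖ls‖ + 1)
  have hmajorant_le := mul_le_mul_of_nonneg_left hbound_le (by positivity : 0 ≤ ‖ls‖ + 1)
  rw [← integral_const_mul, mul_left_comm, mul_add, ← mul_assoc _ (c * V)] at hmajorant_le
  obtain ⟨hgap, hgap_le⟩ := integrable_and_norm_integral_le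
    ((hR.measurable_objective_erg hP κ T).sub_const _).aestronglyMeasurable hmajorant
    (fun ω => (hpath ω).2) hmajorant_le
  refine ⟨⟨?_, hgap_le⟩, integrable_and_norm_integral_le
    (hR.stronglyMeasurable_resid_erg κ T).norm.aestronglyMeasurable hmajorant (fun ω => ?_)
    hmajorant_le⟩
  · simpa only [Pi.add_def, sub_add_cancel] using
      hgap.add (integrable_const (P.f xs + P.gReal ys))
  · rw [norm_norm]
    exact (hpath ω).1.trans (le_mul_of_one_le_left ((norm_nonneg _).trans (hpath ω).1)
      (le_add_of_nonneg_left (norm_nonneg _)))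

end Expectation

end Trajectory

end SASADMM

theorem mainTheorem1 {n n₁ n₂ N : ℕ} {Ω : Type*} [MeasurableSpace Ω]
    (μ : Measure Ω) [IsProbabilityMeasure μ]
    (𝓖 : Filtration (ℕ ×ₗ ℕ) (inferInstance : MeasurableSpace Ω))
    (P : SASADMM.Problem n n₁ n₂ N) (S : SASADMM.Params n₁ n₂)
    (Z : SASADMM.Trajectory n n₁ n₂ N Ω)
    (hP : P.Standing)
    (hβ : 0 < S.β) (hH : S.H.PosDef) (hL : S.L.PosSemidef)
    (hΔ : (S.τ, S.s) ∈ SASADMM.Delta)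
    (ν : ℝ) (hν : 0 < ν) (hLip : P.GradLipschitz S.H ν)
    -- the choice of the inner iteration counts and inner stepsizes
    (c₁ c₂ c₃ ϱ : ℝ) (m : ℕ) (hc₁ : 0 < c₁) (hc₂ : 0 < c₂) (hc₃ : 0 < c₃)
    (hϱ : 1 ≤ ϱ) (hm : 0 < m)
    (hmk : ∀ k : ℕ, S.m k = max ⌈c₃ * (k : ℝ) ^ ϱ⌉₊ m)
    (hηk : ∀ k : ℕ, S.η k = min (c₁ / ((S.m k : ℝ) * ((S.m k : ℝ) + 1))) c₂)
    (hRun : Z.IsRun P S μ 𝓖)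
    -- the conditions on the iterations `k ≥ κ`
    (κ : ℕ) (hκ : 0 < κ)
    (hη : ∀ k ≥ κ, S.η k ≤ 1 / (2 * ν))
    (hD : ∀ k ≥ κ, ∀ ω, (Z.D P S k ω - Z.D P S (k + 1) ω).PosSemidef)
    (hMκ : ∃ R : ℝ, ∀ ω, (R • (1 : Matrix (Fin n₁) (Fin n₁) ℝ) - Z.M κ ω).PosSemidef)
    (hδ : ∀ k, ∀ t ∈ Finset.Icc 1 (S.m k),
      Integrable (fun ω => SASADMM.sqNormW S.H⁻¹ (Z.δ P k t ω)) μ)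
    (σ : ℝ) (hσ : 0 < σ)
    (hδσ : ∀ k ≥ κ, ∀ t ∈ Finset.Icc 1 (S.m k),
      ∫ ω, SASADMM.sqNormW S.H⁻¹ (Z.δ P k t ω) ∂μ ≤ σ ^ 2)
    -- a saddle point
    (xs : SASADMM.Vec n₁) (ys : SASADMM.Vec n₂) (ls : SASADMM.Vec n)
    (hw : P.IsSaddlePoint xs ys ls) :
    -- all objective values are finite and all expectations exist
    P.F xs ys ≠ ⊤ ∧
    (∀ T ω, P.F (Z.xErg κ T ω) (Z.yErg κ T ω) ≠ ⊤) ∧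
    (∀ T, Integrable (fun ω => (P.F (Z.xErg κ T ω) (Z.yErg κ T ω)).toReal) μ) ∧
    (∀ T, Integrable (fun ω => ‖P.resid (Z.xErg κ T ω) (Z.yErg κ T ω)‖) μ) ∧
    -- the rates
    (1 < ϱ →
      (fun T : ℕ =>
        |∫ ω, ((P.F (Z.xErg κ T ω) (Z.yErg κ T ω)).toReal - (P.F xs ys).toReal) ∂μ|)
          =O[atTop] (fun T : ℕ => 1 / (T : ℝ)) ∧
      (fun T : ℕ => ∫ ω, ‖P.resid (Z.xErg κ T ω) (Z.yErg κ T ω)‖ ∂μ)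
          =O[atTop] (fun T : ℕ => 1 / (T : ℝ))) ∧
    (ϱ = 1 →
      (fun T : ℕ =>
        |∫ ω, ((P.F (Z.xErg κ T ω) (Z.yErg κ T ω)).toReal - (P.F xs ys).toReal) ∂μ|)
          =O[atTop] (fun T : ℕ => Real.log (T : ℝ) / (T : ℝ)) ∧
      (fun T : ℕ => ∫ ω, ‖P.resid (Z.xErg κ T ω) (Z.yErg κ T ω)‖ ∂μ)
          =O[atTop] (fun T : ℕ => Real.log (T : ℝ) / (T : ℝ))) := by
  have hS := SASADMM.Params.isAdmissible_of_m_eq_of_η_eq hβ hH hL hΔ hc₁ hc₂ hc₃.le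
    (zero_le_one.trans hϱ) hm hmk hηk
  have hη_le (k : ℕ) : S.η k ≤ c₁ / ((S.m k : ℝ) * (S.m k + 1)) :=
    (hηk k).trans_le (min_le_left _ _)
  obtain ⟨K, C, hbound⟩ := hRun.exists_abs_integral_ergodic_le hP hS hν hLip hκ hη hD hMκ
    (fun k t ht => hRun.sampling.memLp_δ hH ht (hδ k t ht)) (fun k _ => hη_le k) (sq_nonneg σ)
    hδσ hw
  have hF (T : ℕ) (ω : Ω) := hP.F_eq (Z.xErg κ T ω) ((hRun.updates ω).yErg_mem hP κ T)
  simp only [hF, hP.F_eq xs (hw.mem_dom hP), EReal.toReal_coe]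
  have hobj_le (T : ℕ) := (hbound T).1.2
  have hres_le (T : ℕ) := (hbound T).2.2
  refine ⟨EReal.coe_ne_top _, fun _ _ => EReal.coe_ne_top _, fun T => (hbound T).1.1,
    fun T => (hbound T).2.1, fun hϱ₁ => ?_, fun hϱ₁ => ?_⟩
  · have hsum := SASADMM.isBigO_sum_Icc_one_of_summable
      (SASADMM.Params.summable_one_div_m hc₃ hϱ₁ hmk) (fun _ => by positivity) κ
    exact ⟨(SASADMM.isBigO_div_of_abs_le hobj_le hsum (isBigO_refl _ _)).abs_left,
      SASADMM.isBigO_div_of_abs_le hres_le hsum (isBigO_refl _ _)⟩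
  · have hsum := SASADMM.isBigO_sum_Icc_log (a := fun k => 1 / (S.m k : ℝ)) hκ
      (fun _ => by positivity) fun k hk => by
        simpa only [hϱ₁, Real.rpow_one] using SASADMM.Params.one_div_m_le hc₃ hmk (hκ.trans_le hk)
    have hone := SASADMM.isBigO_one_log_natCast
    exact ⟨(SASADMM.isBigO_div_of_abs_le hobj_le hsum hone).abs_left,
      SASADMM.isBigO_div_of_abs_le hres_le hsum hone⟩
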